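/- Let $\alpha>0$ and let $G^2_\alpha$ be the $\alpha$-Grushin plane, i.e. $\mathbb R^2$ with the vector fields $X=\partial_x$, $Y_\alpha=|x|^\alpha\partial_y$. For an open set $\Omega\subset\mathbb R^2$ and $p\ge 1$, let $HW^{1,p}(\Omega)$ be the space of functions $u\in L^p(\Omega)$ (Lebesgue measure) which have weak first partial derivatives and satisfy $Xu,\,Y_\alpha u\in L^p(\Omega)$. A map $g=(g_1,g_2):\Omega\to\Omega'$ belongs to $HW^{1,p}_{\mathrm{loc}}(\Omega,\Omega')$ if $g_1,g_2\in HW^{1,p}(U)$ for every open $U\subset\subset\Omega$. Partial derivatives of such maps below are the classical ones, which exist almost everywhere. A homeomorphism $g=(g_1,g_2)$ of an open set $\Omega$ onto an open set $\Omega'$ with $g\in HW^{1,2}_{\mathrm{loc}}(\Omega,\Omega')$ is called conformal if, with $S_g=\{(x,y)\in\Omega : x=0 \text{ or } g_1(x,y)=0\}$, $R_g=\Omega\setminus S_g$ and $$D_\alpha g=\begin{bmatrix} Xg_1 & Y_\alpha g_1\\ |g_1|^{-\alpha}Xg_2 & |g_1|^{-\alpha}Y_\alpha g_2\end{bmatrix},$$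 (1) at almost every point of $R_g$ the matrix $D_\alpha g$ is a positive multiple of an orthogonal matrix, and (2) for every $p_0\in S_g$ the limit of $D_\alpha g(p)$ as $R_g\ni p\to p_0$ exists, is finite and is not the zero matrix. A map $g\in HW^{1,1}_{\mathrm{loc}}(\Omega,\Omega')$ is called orientation preserving if $Xg_1\,Y_\alpha g_2-Y_\alpha g_1\,Xg_2>0$ almost everywhere in $\Omega$. A curve $\gamma:[a,b]\to\mathbb R^2$ is called (horizontally) admissible if it is absolutely continuous in the Euclidean metric and there are $u_1,u_2\in L^1([a,b])$ such that $\gamma'(t)=u_1(t)X(\gamma(t))+u_2(t)Y_\alpha(\gamma(t))$ for a.e. $t\in[a,b]$. Let $\Omega,\Omega'\subset G^2_\alpha$ be open and let $g\in HW^{1,\frac{2(\alpha+1)}{\alpha}}_{\mathrm{loc}}(\Omega,\Omega')$ (in particular, $g\in HW^{1,\frac{2(\alpha+1)}{\alpha}}(\Omega,\Omega')$ is allowed) be an orientation preserving conformal map. Let $\gamma=(\gamma_1,\gamma_2):[a,b]\to\Omega$ be absolutely continuous in the Euclidean metric with $\gamma_1\neq 0$ a.e. in $[a,b]$. Then $\gamma$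 is admissible if and only if $g\circ\gamma$ is admissible. -/

import Mathlib

open MeasureTheory Set Filter Topology
open scoped ContDiff ENNReal

namespace Grushin

/-- The plane `ℝ²` with coordinates `(x, y)`; it carries Lebesgue measure and its usual topology. -/
abbrev Plane : Type := ℝ × ℝ

/-- The classical partial derivative `∂u/∂x` at a point (`0` where it does not exist). -/
noncomputable def partialX (u : Plane → ℝ) (p : Plane) : ℝ :=
  deriv (fun s : ℝ => u (s, p.2)) p.1

/-- The classical partial derivative `∂u/∂y` at a point (`0` where it does not exist). -/
noncomputable def partialY (u : Plane → ℝ) (p : Plane) : ℝ :=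
  deriv (fun s : ℝ => u (p.1, s)) p.2

/-- Both classical first order partial derivatives of `u` exist at `p`. -/
def PartialsExistAt (u : Plane → ℝ) (p : Plane) : Prop :=
  DifferentiableAt ℝ (fun s : ℝ => u (s, p.2)) p.1 ∧
    DifferentiableAt ℝ (fun s : ℝ => u (p.1, s)) p.2

/-- The vector field `X = ∂ₓ` acting on functions. -/
noncomputable def fieldX (u : Plane → ℝ) (p : Plane) : ℝ := partialX u p

/-- The vector field `Y_α = |x|^α ∂_y` acting on functions. -/
noncomputable def fieldY (α : ℝ) (u : Plane → ℝ) (p : Plane) : ℝ :=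
  |p.1| ^ α * partialY u p

/-- `v` is a weak derivative of `u` on the open set `Ω` in the direction `e`: both functions are
locally integrable on `Ω` and `∫_Ω u ∂ₑφ = - ∫_Ω v φ` for all test functions `φ ∈ C_c^∞(Ω)`. -/
def HasWeakDeriv (Ω : Set Plane) (e : Plane) (u v : Plane → ℝ) : Prop :=
  LocallyIntegrableOn u Ω ∧ LocallyIntegrableOn v Ω ∧
    ∀ φ : Plane → ℝ, ContDiff ℝ ∞ φ → HasCompactSupport φ → tsupport φ ⊆ Ω →
      ∫ p in Ω, u p * fderiv ℝ φ p e = -∫ p in Ω, v p * φ p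

/-- The horizontal Sobolev space `HW^{1,p,α}(Ω)`: functions in `L^p(Ω)` having weak first order
partial derivatives `u_x`, `u_y` such that the horizontal gradient `(u_x, |x|^α u_y)` lies in
`L^p(Ω)`. -/
def MemHW (α : ℝ) (p : ℝ≥0∞) (Ω : Set Plane) (u : Plane → ℝ) : Prop :=
  MemLp u p (volume.restrict Ω) ∧
    ∃ ux uy : Plane → ℝ,
      HasWeakDeriv Ω (1, 0) u ux ∧ HasWeakDeriv Ω (0, 1) u uy ∧
      MemLp ux p (volume.restrict Ω) ∧
      MemLp (fun q : Plane => |q.1| ^ α * uy q) p (volume.restrict Ω)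

/-- The horizontal Sobolev space of mappings `HW^{1,p,α}(Ω, Ω')`. -/
def MemHWMap (α : ℝ) (p : ℝ≥0∞) (Ω Ω' : Set Plane) (g : Plane → Plane) : Prop :=
  MapsTo g Ω Ω' ∧ MemHW α p Ω (fun q => (g q).1) ∧ MemHW α p Ω (fun q => (g q).2)

/-- The local horizontal Sobolev space of mappings `HW_loc^{1,p,α}(Ω, Ω')`. -/
def MemHWMapLoc (α : ℝ) (p : ℝ≥0∞) (Ω Ω' : Set Plane) (g : Plane → Plane) : Prop :=
  MapsTo g Ω Ω' ∧
    ∀ U : Set Plane, IsOpen U → IsCompact (closure U) → closure U ⊆ Ω → MemHWMap α p U Ω' g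

/-- `g` restricts to a homeomorphism of `Ω` onto `Ω'`. -/
def IsHomeoOnto (g : Plane → Plane) (Ω Ω' : Set Plane) : Prop :=
  MapsTo g Ω Ω' ∧ ContinuousOn g Ω ∧
    ∃ h : Plane → Plane, MapsTo h Ω' Ω ∧ ContinuousOn h Ω' ∧ InvOn h g Ω Ω'

/-- The singular set `S_g`. -/
def singularSet (Ω : Set Plane) (g : Plane → Plane) : Set Plane :=
  {p | p ∈ Ω ∧ (p.1 = 0 ∨ (g p).1 = 0)}

/-- The regular set `R_g = Ω \ S_g`. -/
def regularSet (Ω : Set Plane) (g : Plane → Plane) : Set Plane :=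
  Ω \ singularSet Ω g

/-- The matrix `D_α g`. -/
noncomputable def matrixD (α : ℝ) (g : Plane → Plane) (p : Plane) : Matrix (Fin 2) (Fin 2) ℝ :=
  !![fieldX (fun q => (g q).1) p, fieldY α (fun q => (g q).1) p;
     fieldX (fun q => (g q).2) p / |(g p).1| ^ α, fieldY α (fun q => (g q).2) p / |(g p).1| ^ α]

/-- The matrix `D_H g`, whose determinant is the Jacobian `J_g`. -/
noncomputable def matrixDH (α : ℝ) (g : Plane → Plane) (p : Plane) : Matrix (Fin 2) (Fin 2) ℝ :=
  !![fieldX (fun q => (g q).1) p, fieldY α (fun q => (g q).1) p;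
     fieldX (fun q => (g q).2) p, fieldY α (fun q => (g q).2) p]

/-- Conformal mappings between open subsets `Ω`, `Ω'` of the `α`-Grushin plane. -/
structure IsConformal (α : ℝ) (Ω Ω' : Set Plane) (g : Plane → Plane) : Prop where
  sobolev : MemHWMapLoc α 2 Ω Ω' g
  homeo : IsHomeoOnto g Ω Ω'
  /-- Almost everywhere in `R_g`, `D_α g` is a positive multiple of an orthogonal matrix. -/
  conformal_ae : ∀ᵐ p ∂(volume.restrict (regularSet Ω g)),
    ∃ c : ℝ, 0 < c ∧ ∃ O ∈ Matrix.orthogonalGroup (Fin 2) ℝ, matrixD α g p = c • O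
  /-- At each point of `S_g` the matrix `D_α g` has a finite nonzero limit along `R_g` (that is,
  along those points of `R_g` where the partial derivatives, hence `D_α g`, exist). -/
  limit_singular : ∀ p₀ ∈ singularSet Ω g, ∃ L : Matrix (Fin 2) (Fin 2) ℝ, L ≠ 0 ∧
    Tendsto (matrixD α g)
      (𝓝[{p | p ∈ regularSet Ω g ∧ PartialsExistAt (fun q => (g q).1) p ∧
        PartialsExistAt (fun q => (g q).2) p}] p₀) (𝓝 L)

/-- Orientation preserving Sobolev mappings: `J_g > 0` almost everywhere in `Ω`. -/
def IsOrientationPreserving (α : ℝ) (Ω Ω' : Set Plane) (g : Plane → Plane) : Prop :=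
  MemHWMapLoc α 1 Ω Ω' g ∧ ∀ᵐ p ∂(volume.restrict Ω), 0 < (matrixDH α g p).det

/-- A curve `γ : [a, b] → ℝ²` is (horizontally) admissible: it is absolutely continuous in the
Euclidean sense and, for some `u₁, u₂ ∈ L¹([a, b])`, for a.e. `t ∈ [a, b]`,
`γ'(t) = u₁(t) X(γ(t)) + u₂(t) Y_α(γ(t))`, where `X(x, y) = (1, 0)`, `Y_α(x, y) = (0, |x|^α)`. -/
def IsAdmissible (α a b : ℝ) (γ : ℝ → Plane) : Prop :=
  AbsolutelyContinuousOnInterval γ a b ∧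
    ∃ u₁ u₂ : ℝ → ℝ, IntegrableOn u₁ (Icc a b) ∧ IntegrableOn u₂ (Icc a b) ∧
      ∀ᵐ t ∂(volume.restrict (Icc a b)),
        HasDerivAt γ (u₁ t • ((1, 0) : Plane) + u₂ t • ((0, |(γ t).1| ^ α) : Plane)) t

end Grushin

open scoped NNReal

/-! Put `u = powChart α x`, the odd primitive of `|x|^α`. Off the line `x = 0` the Grushin metric
`dx² + |x|^(-2α) dy²` equals `|x|^(-2α) (du² + dy²)`, so in the coordinates `u + iy` it is conformal
to the Euclidean metric. Write `F` for the map `g` read in these coordinates (`chartMap`). A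
positive multiple of an orthogonal matrix with positive determinant satisfies the Cauchy-Riemann
equations, so `g` satisfies weighted equations almost everywhere which are formally those of `F`
(`IsConformal.ae_cauchyRiemann`).

These equations hold only almost everywhere. The Sobolev condition makes the continuous map `g`
absolutely continuous on almost every line, with locally integrable classical derivatives
(`IsACLX`). Fubini's theorem then gives Green's formula on every box, including boxes that cross the
singular line, and Morera's theorem makes `F` holomorphic
(`IsWeaklyConformal.differentiableOn_chartMap`). As `F` is injective, `F'` has no zeros
(`deriv_ne_zero_of_injOn`).

Off the singular set, `|g₁|^(2α) ‖D_α g‖² = 2 |x|^(2α) |F'|²` in the Frobenius norm. Passing to the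
nonzero limit required at singular points shows that `g₁ = 0` exactly when `x = 0`
(`IsConformal.fst_eq_zero_iff`). Hence `F` maps the imaginary axis to itself, `Im F' = 0` there, and
near the axis `Im F' = O(|u|)` and `|Re F|` is comparable to `|u|`. So locally `|g₁|^α` and `|x|^α`
are comparable, `|Im F'| ≤ C |x|^α`, and `|x|^α + |Re F'|` is bounded below
(`IsChartHolomorphic.exists_chartBound`).

Along a curve, `(g₁)' = |g₁|^(-α) (|x|^α Re F' x' - Im F' y')` and `(g₂)' = |x|^α Im F' x' + Re F'
y'`. The bounds make `g` locally Lipschitz, so `g ∘ γ` is absolutely continuous, and they turn `y' =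
|x|^α u₂` into `(g₂)' = |g₁|^α U₂` with `U₂` integrable. For the converse, the second formula is
solved for `y'`. -/

namespace Grushin

/-! ### The chart on the `x`-axis -/

/-- The odd primitive of `|x|^α`. -/
noncomputable def powChart (α x : ℝ) : ℝ := x * |x| ^ α / (α + 1)

lemma powChart_of_nonneg {α x : ℝ} (hα : 0 < α) (hx : 0 ≤ x) :
    powChart α x = x ^ (α + 1) / (α + 1) := by
  rw [powChart, abs_of_nonneg hx, Real.rpow_add_one' hx (by linarith), mul_comm]

lemma powChart_neg (α x : ℝ) : powChart α (-x) = -powChart α x := by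
  simp only [powChart, abs_neg]; ring

lemma abs_powChart {α : ℝ} (hα : 0 < α) (x : ℝ) :
    |powChart α x| = |x| ^ (α + 1) / (α + 1) := by
  have h : 0 ≤ |x| ^ α := by positivity
  rw [powChart, abs_div, abs_mul, abs_of_nonneg h, abs_of_pos (by linarith : 0 < α + 1),
    Real.rpow_add_one' (abs_nonneg x) (by linarith), mul_comm]

lemma powChart_eq_zero {α : ℝ} (hα : 0 < α) {x : ℝ} : powChart α x = 0 ↔ x = 0 := by
  rw [← abs_eq_zero, abs_powChart hα, div_eq_zero_iff,
    Real.rpow_eq_zero (abs_nonneg x) (by linarith), abs_eq_zero]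
  constructor
  · rintro (h | h)
    · exact h
    · linarith
  · exact Or.inl

lemma continuous_abs_rpow {α : ℝ} (hα : 0 < α) : Continuous fun x : ℝ => |x| ^ α :=
  continuous_abs.rpow_const fun _ => Or.inr hα.le

lemma hasDerivAt_powChart {α : ℝ} (hα : 0 < α) (x : ℝ) :
    HasDerivAt (powChart α) (|x| ^ α) x := by
  have hpos : ∀ x : ℝ, 0 < x → HasDerivAt (powChart α) (|x| ^ α) x := fun x hx => by
    have h := (Real.hasDerivAt_rpow_const (x := x) (p := α + 1) (Or.inl hx.ne')).div_const (α + 1)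
    have e : (α + 1) * x ^ (α + 1 - 1) / (α + 1) = |x| ^ α := by
      rw [abs_of_pos hx, add_sub_cancel_right]; field_simp
    rw [e] at h
    refine h.congr_of_eventuallyEq ?_
    filter_upwards [lt_mem_nhds hx] with y hy using powChart_of_nonneg hα (le_of_lt hy)
  rcases lt_trichotomy x 0 with hx | rfl | hx
  · have h := (hpos (-x) (by linarith)).scomp x (hasDerivAt_neg x)
    have h2 := h.neg
    simp only [abs_neg, neg_smul, one_smul, neg_neg] at h2
    refine h2.congr_of_eventuallyEq (Eventually.of_forall fun y => ?_)
    simp [powChart_neg]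
  · rw [hasDerivAt_iff_tendsto_slope]
    -- At the origin the difference quotient is `|y|^α / (α + 1)`, which tends to `0 = |0|^α`
    -- because `α > 0`.
    have hc : Tendsto (fun y : ℝ => |y| ^ α / (α + 1)) (𝓝[≠] 0) (𝓝 (|0| ^ α)) := by
      have := ((continuous_abs_rpow hα).div_const (α + 1)).tendsto 0
      simp only [abs_zero, Real.zero_rpow hα.ne', zero_div] at this ⊢
      exact this.mono_left nhdsWithin_le_nhds
    refine hc.congr' ?_
    filter_upwards [self_mem_nhdsWithin] with y hy
    have hy : y ≠ 0 := hy
    simp only [slope_def_field, powChart]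
    field_simp
    simp
  · exact hpos x hx

lemma continuous_powChart {α : ℝ} (hα : 0 < α) : Continuous (powChart α) :=
  continuous_iff_continuousAt.2 fun x => (hasDerivAt_powChart hα x).continuousAt

lemma tendsto_powChart_atTop {α : ℝ} (hα : 0 < α) : Tendsto (powChart α) atTop atTop := by
  have h : Tendsto (fun x : ℝ => x ^ (α + 1) / (α + 1)) atTop atTop :=
    (tendsto_rpow_atTop (by linarith : 0 < α + 1)).atTop_div_const (by linarith)
  refine h.congr' ?_
  filter_upwards [eventually_ge_atTop 0] with x hx using (powChart_of_nonneg hα hx).symm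

lemma surjective_powChart {α : ℝ} (hα : 0 < α) : Function.Surjective (powChart α) := by
  refine (continuous_powChart hα).surjective (tendsto_powChart_atTop hα) ?_
  have h := tendsto_neg_atTop_atBot.comp ((tendsto_powChart_atTop hα).comp tendsto_neg_atBot_atTop)
  refine h.congr fun x => ?_
  simp [powChart_neg]

lemma strictMono_powChart {α : ℝ} (hα : 0 < α) : StrictMono (powChart α) := by
  have hpos : StrictMonoOn (powChart α) (Ici 0) := by
    intro x hx y hy hxy
    rw [powChart_of_nonneg hα hx, powChart_of_nonneg hα hy]
    have := Real.rpow_lt_rpow hx hxy (by linarith : 0 < α + 1)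
    have : 0 < α + 1 := by linarith
    gcongr
  have hneg : StrictMonoOn (powChart α) (Iic 0) := by
    intro x hx y hy hxy
    have := hpos (mem_Ici.2 (neg_nonneg.2 hy)) (mem_Ici.2 (neg_nonneg.2 hx)) (neg_lt_neg hxy)
    simpa [powChart_neg] using this
  exact hneg.Iic_union_Ici hpos

/-- `powChart α` as a homeomorphism of the line. -/
noncomputable def powHomeo (α : ℝ) (hα : 0 < α) : ℝ ≃ₜ ℝ :=
  ((strictMono_powChart hα).orderIsoOfSurjective _ (surjective_powChart hα)).toHomeomorph

lemma powChart_symm {α : ℝ} (hα : 0 < α) (u : ℝ) :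
    powChart α ((powHomeo α hα).symm u) = u :=
  (powHomeo α hα).apply_symm_apply u

lemma symm_powChart {α : ℝ} (hα : 0 < α) (x : ℝ) :
    (powHomeo α hα).symm (powChart α x) = x :=
  (powHomeo α hα).symm_apply_apply x

/-- The inverse chart has infinite slope at the origin. This is why the chain rule for the first
component of `g` is only available where that component is nonzero. -/
lemma hasDerivAt_powHomeo_symm {α : ℝ} (hα : 0 < α) {x : ℝ} (hx : x ≠ 0) :
    HasDerivAt (powHomeo α hα).symm (|x| ^ α)⁻¹ (powChart α x) := by
  have h : HasDerivAt (powChart α) (|x| ^ α) ((powHomeo α hα).symm (powChart α x)) := by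
    rw [symm_powChart]; exact hasDerivAt_powChart hα x
  exact h.of_local_left_inverse (powHomeo α hα).symm.continuous.continuousAt (by positivity)
    (Eventually.of_forall fun u => powChart_symm hα u)

/-! ### Smoothed indicator functions and integration by parts on the line -/

/-- A smooth step increasing from `0` to `1` on `[r, r + 1 / n]`. -/
noncomputable def smoothStep (n : ℕ) (r x : ℝ) : ℝ := Real.smoothTransition (n * (x - r))

/-- Smooth approximations of the indicator function of `(r, s]`. -/
noncomputable def smoothPlateau (n : ℕ) (r s x : ℝ) : ℝ := smoothStep n r x - smoothStep n s x

lemma contDiff_smoothStep (n : ℕ) (r : ℝ) : ContDiff ℝ ∞ (smoothStep n r) :=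
  Real.smoothTransition.contDiff.comp (contDiff_const.mul (contDiff_id.sub contDiff_const))

lemma contDiff_smoothPlateau (n : ℕ) (r s : ℝ) : ContDiff ℝ ∞ (smoothPlateau n r s) :=
  (contDiff_smoothStep n r).sub (contDiff_smoothStep n s)

lemma tendsto_smoothStep (r x : ℝ) :
    Tendsto (fun n => smoothStep n r x) atTop (𝓝 (if r < x then 1 else 0)) := by
  split_ifs with h
  · have h1 : Tendsto (fun n : ℕ => (n : ℝ) * (x - r)) atTop atTop :=
      tendsto_natCast_atTop_atTop.atTop_mul_const (sub_pos.2 h)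
    refine tendsto_const_nhds.congr' ?_
    filter_upwards [h1.eventually_ge_atTop 1] with n hn
      using (Real.smoothTransition.one_of_one_le hn).symm
  · refine tendsto_const_nhds.congr fun n => ?_
    exact (Real.smoothTransition.zero_of_nonpos
      (mul_nonpos_of_nonneg_of_nonpos (Nat.cast_nonneg n) (by linarith))).symm

lemma abs_smoothPlateau_le (n : ℕ) (r s x : ℝ) : |smoothPlateau n r s x| ≤ 1 := by
  have h1 := Real.smoothTransition.nonneg (n * (x - r))
  have h2 := Real.smoothTransition.le_one (n * (x - r))
  have h3 := Real.smoothTransition.nonneg (n * (x - s))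
  have h4 := Real.smoothTransition.le_one (n * (x - s))
  rw [smoothPlateau, smoothStep, smoothStep, abs_le]
  constructor <;> linarith

lemma tsupport_smoothPlateau_subset {n : ℕ} (hn : 0 < n) {r s : ℝ} (hrs : r ≤ s) :
    tsupport (smoothPlateau n r s) ⊆ Icc r (s + 1 / n) := by
  have hn' : (0 : ℝ) < n := Nat.cast_pos.2 hn
  refine closure_minimal (fun x hx => ?_) isClosed_Icc
  by_contra h
  apply hx
  rw [mem_Icc, not_and_or, not_le, not_le] at h
  rw [smoothPlateau, smoothStep, smoothStep]
  rcases h with h | h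
  · rw [Real.smoothTransition.zero_of_nonpos, Real.smoothTransition.zero_of_nonpos, sub_self]
    · exact mul_nonpos_of_nonneg_of_nonpos hn'.le (by linarith)
    · exact mul_nonpos_of_nonneg_of_nonpos hn'.le (by linarith)
  · have h2 : 1 < n * (x - s) := by
      have : 1 / (n : ℝ) < x - s := by linarith
      rwa [div_lt_iff₀' hn'] at this
    rw [Real.smoothTransition.one_of_one_le, Real.smoothTransition.one_of_one_le h2.le, sub_self]
    exact h2.le.trans (by gcongr)

lemma continuous_deriv_smoothTransition : Continuous (deriv Real.smoothTransition) :=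
  (Real.smoothTransition.contDiff (n := 1)).continuous_deriv le_rfl

lemma deriv_smoothTransition_eq_zero {t : ℝ} (ht : t ∉ Icc (0 : ℝ) 1) :
    deriv Real.smoothTransition t = 0 := by
  rw [mem_Icc, not_and_or, not_le, not_le] at ht
  rcases ht with ht | ht
  · have : Real.smoothTransition =ᶠ[𝓝 t] fun _ => 0 := by
      filter_upwards [gt_mem_nhds ht] with y hy
        using Real.smoothTransition.zero_of_nonpos (le_of_lt hy)
    rw [this.deriv_eq, deriv_const]
  · have : Real.smoothTransition =ᶠ[𝓝 t] fun _ => 1 := by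
      filter_upwards [lt_mem_nhds ht] with y hy
        using Real.smoothTransition.one_of_one_le (le_of_lt hy)
    rw [this.deriv_eq, deriv_const]

lemma deriv_smoothStep (n : ℕ) (r x : ℝ) :
    deriv (smoothStep n r) x = n * deriv Real.smoothTransition (n * (x - r)) := by
  have h := ((Real.smoothTransition.contDiff (n := 1)).differentiable (by norm_num)
    (n * (x - r))).hasDerivAt
  have h2 : HasDerivAt (fun x : ℝ => (n : ℝ) * (x - r)) n x := by
    simpa using ((hasDerivAt_id x).sub_const r).const_mul (n : ℝ)
  have h3 : HasDerivAt (smoothStep n r) _ x := h.comp x h2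
  rw [h3.deriv, mul_comm]

/-- The substitution `x = r + t / n` turns `n` into a parameter `ε = 1 / n` on which the right-hand
side depends continuously, also at `ε = 0`. This yields the limit as `n → ∞`. -/
lemma integral_mul_deriv_smoothStep {n : ℕ} (hn : 0 < n) (k : ℝ → ℝ) (r : ℝ) :
    ∫ x, k x * deriv (smoothStep n r) x =
      ∫ t in (0 : ℝ)..1, k (r + (1 / n : ℝ) * t) * deriv Real.smoothTransition t := by
  have hn' : (0 : ℝ) < n := Nat.cast_pos.2 hn
  have h0 : ∀ t ∉ Icc (0 : ℝ) 1, k (r + (1 / n : ℝ) * t) * deriv Real.smoothTransition t = 0 :=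
    fun t ht => by rw [deriv_smoothTransition_eq_zero ht, mul_zero]
  rw [intervalIntegral.integral_of_le zero_le_one, ← integral_Icc_eq_integral_Ioc,
    setIntegral_eq_integral_of_forall_compl_eq_zero h0,
    ← integral_add_right_eq_self (fun x => k x * deriv (smoothStep n r) x) r]
  have := Measure.integral_comp_mul_left
    (fun t => n * (k (r + (1 / n : ℝ) * t) * deriv Real.smoothTransition t)) (n : ℝ)
  rw [integral_const_mul, integral_const_mul, abs_of_pos (by positivity), smul_eq_mul,
    inv_mul_cancel_left₀ hn'.ne'] at this
  rw [← this, ← integral_const_mul]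
  congr 1
  ext x
  rw [deriv_smoothStep, add_sub_cancel_right]
  have : r + 1 / (n : ℝ) * (n * x) = x + r := by field_simp; ring
  rw [this]; ring

lemma tendsto_integral_mul_deriv_smoothStep {k : ℝ → ℝ} (hk : Continuous k) (r : ℝ) :
    Tendsto (fun n : ℕ => ∫ x, k x * deriv (smoothStep n r) x) atTop (𝓝 (k r)) := by
  have hc : Continuous fun ε : ℝ =>
      ∫ t in (0 : ℝ)..1, k (r + ε * t) * deriv Real.smoothTransition t := by
    refine intervalIntegral.continuous_parametric_intervalIntegral_of_continuous' ?_ 0 1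
    have := continuous_deriv_smoothTransition
    fun_prop
  -- At `ε = 0` the integrand is `k r` times the derivative of a function rising from `0` to `1`.
  have h1 : ∫ t in (0 : ℝ)..1, k (r + 0 * t) * deriv Real.smoothTransition t = k r := by
    simp only [zero_mul, add_zero]
    rw [intervalIntegral.integral_const_mul, intervalIntegral.integral_deriv_eq_sub
      (fun x _ => (Real.smoothTransition.contDiff (n := 1)).differentiable (by norm_num) x)
      (continuous_deriv_smoothTransition.intervalIntegrable _ _)]
    simp
  have h2 := (hc.tendsto 0).comp tendsto_one_div_atTop_nhds_zero_nat
  rw [h1] at h2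
  refine h2.congr' ?_
  filter_upwards [eventually_gt_atTop 0] with n hn
  exact (integral_mul_deriv_smoothStep hn k r).symm

lemma integrable_mul_deriv_smoothStep {k : ℝ → ℝ} (hk : Continuous k) {n : ℕ} (hn : 0 < n)
    (r : ℝ) : Integrable fun x => k x * deriv (smoothStep n r) x := by
  have hn' : (0 : ℝ) < n := Nat.cast_pos.2 hn
  have hc : Continuous fun x => k x * deriv (smoothStep n r) x :=
    hk.mul ((contDiff_smoothStep n r).continuous_deriv (by norm_cast))
  refine hc.integrable_of_hasCompactSupport ?_
  refine HasCompactSupport.intro (isCompact_Icc (a := r) (b := r + 1 / n)) fun x hx => ?_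
  rw [deriv_smoothStep, deriv_smoothTransition_eq_zero, mul_zero, mul_zero]
  contrapose! hx
  obtain ⟨h1, h2⟩ := hx
  constructor
  · nlinarith
  · have : x - r ≤ 1 / n := by rwa [le_div_iff₀' hn']
    linarith

/-- A continuous function whose weak derivative is `v`, when tested against the smooth
approximations of `(r, s]`, has increment `∫ v` over `(r, s]`. -/
lemma sub_eq_integral_of_forall_smoothPlateau {k v : ℝ → ℝ} (hk : Continuous k)
    (hv : Integrable v) {r s : ℝ} (hrs : r ≤ s)
    (h : ∀ᶠ n : ℕ in atTop, ∫ x, k x * deriv (smoothPlateau n r s) x =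
      -∫ x, v x * smoothPlateau n r s x) :
    k s - k r = ∫ x in r..s, v x := by
  have h1 : Tendsto (fun n : ℕ => ∫ x, k x * deriv (smoothPlateau n r s) x) atTop
      (𝓝 (k r - k s)) := by
    refine ((tendsto_integral_mul_deriv_smoothStep hk r).sub
      (tendsto_integral_mul_deriv_smoothStep hk s)).congr' ?_
    filter_upwards [eventually_gt_atTop 0] with n hn
    rw [← integral_sub (integrable_mul_deriv_smoothStep hk hn r)
      (integrable_mul_deriv_smoothStep hk hn s)]
    congr 1
    ext x
    have hd : ∀ r, DifferentiableAt ℝ (smoothStep n r) x := fun r =>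
      (contDiff_smoothStep n r).differentiable (by simp) x
    have : deriv (smoothPlateau n r s) x = deriv (smoothStep n r) x - deriv (smoothStep n s) x :=
      ((hd r).hasDerivAt.sub (hd s).hasDerivAt).deriv
    rw [this, mul_sub]
  have h2 : Tendsto (fun n : ℕ => ∫ x, v x * smoothPlateau n r s x) atTop
      (𝓝 (∫ x, (Ioc r s).indicator v x)) := by
    refine tendsto_integral_of_dominated_convergence (fun x => |v x|) (fun n => ?_) hv.abs
      (fun n => Eventually.of_forall fun x => ?_) (Eventually.of_forall fun x => ?_)
    · exact hv.1.mul (contDiff_smoothPlateau n r s).continuous.aestronglyMeasurable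
    · rw [norm_mul, Real.norm_eq_abs, Real.norm_eq_abs]
      exact mul_le_of_le_one_right (abs_nonneg _) (abs_smoothPlateau_le n r s x)
    · have h := ((tendsto_smoothStep r x).sub (tendsto_smoothStep s x)).const_mul (v x)
      convert h using 1
      congr 1
      by_cases h1 : r < x <;> by_cases h2 : s < x
      · simp [h1, h2]
      · simp [h1, h2, not_lt.1 h2]
      · exact absurd (hrs.trans_lt h2) h1
      · simp [h1, h2]
  rw [integral_indicator measurableSet_Ioc, ← intervalIntegral.integral_of_le hrs] at h2
  have h3 := tendsto_nhds_unique (h1.congr' h) h2.neg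
  linarith

/-! ### Absolute continuity on almost every line -/

lemma hasCompactSupport_of_tsupport_subset_Ioo {η : ℝ → ℝ} {a b : ℝ}
    (h : tsupport η ⊆ Ioo a b) : HasCompactSupport η :=
  isCompact_Icc.of_isClosed_subset (isClosed_tsupport η) (h.trans Ioo_subset_Icc_self)

lemma continuous_integral_left_mul {u : Plane → ℝ} (hu : Continuous u) {ζ : ℝ → ℝ}
    (hζ : Continuous ζ) (hc : HasCompactSupport ζ) :
    Continuous fun y => ∫ x, u (x, y) * ζ x := by
  have h := continuous_parametric_integral_of_continuous (μ := (volume : Measure ℝ))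
    (f := fun y x => u (x, y) * ζ x) (by fun_prop) hc.isCompact
  refine h.congr fun y => ?_
  refine setIntegral_eq_integral_of_forall_compl_eq_zero fun x hx => ?_
  rw [image_eq_zero_of_notMem_tsupport hx, mul_zero]

lemma hasCompactSupport_prod_mul {ζ θ : ℝ → ℝ} (hζ : HasCompactSupport ζ)
    (hθ : HasCompactSupport θ) : HasCompactSupport fun p : Plane => ζ p.1 * θ p.2 := by
  refine HasCompactSupport.intro (hζ.isCompact.prod hθ.isCompact) fun p hp => ?_
  rw [mem_prod, not_and_or] at hp
  rcases hp with hp | hp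
  · rw [image_eq_zero_of_notMem_tsupport hp, zero_mul]
  · rw [image_eq_zero_of_notMem_tsupport hp, mul_zero]

/-- If `v` is the weak `x`-derivative of `u` as far as product test functions are concerned, then
on almost every horizontal line each test function gives an integration by parts formula. -/
lemma ae_integral_mul_deriv_eq {u v : Plane → ℝ} (hu : Continuous u) (hv : Integrable v)
    {a b c d : ℝ}
    (H : ∀ η θ : ℝ → ℝ, ContDiff ℝ ∞ η → ContDiff ℝ ∞ θ → tsupport η ⊆ Ioo a b →
      tsupport θ ⊆ Ioo c d →
      ∫ p, u p * (deriv η p.1 * θ p.2) = -∫ p, v p * (η p.1 * θ p.2))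
    {η : ℝ → ℝ} (hη : ContDiff ℝ ∞ η) (hs : tsupport η ⊆ Ioo a b) :
    ∀ᵐ y, y ∈ Ioo c d → ∫ x, u (x, y) * deriv η x = -∫ x, v (x, y) * η x := by
  have hηc := hasCompactSupport_of_tsupport_subset_Ioo hs
  have hη' : Continuous (deriv η) := hη.continuous_deriv (by norm_cast)
  have hvη : Integrable fun p : Plane => v p * η p.1 := by
    obtain ⟨C, hC⟩ := hηc.exists_bound_of_continuous hη.continuous
    exact hv.mul_bdd (hη.continuous.comp continuous_fst).aestronglyMeasurable
      (Eventually.of_forall fun p => hC p.1)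
  have hloc : LocallyIntegrable fun y => (∫ x, u (x, y) * deriv η x) + ∫ x, v (x, y) * η x :=
    (continuous_integral_left_mul hu hη' hηc.deriv).locallyIntegrable.add
      hvη.integral_prod_right.locallyIntegrable
  -- The difference of the two sides is a locally integrable function of `y`. Testing it against
  -- every `θ` and applying Fubini gives zero, so it vanishes almost everywhere by the fundamental
  -- lemma of the calculus of variations.
  have key := isOpen_Ioo.ae_eq_zero_of_integral_contDiff_smul_eq_zero
    (hloc.locallyIntegrableOn (Ioo c d)) (fun θ hθ hθc hθs => ?_)
  · filter_upwards [key] with y hy hyc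
    linarith [hy hyc]
  have h1 : Integrable fun p : Plane => u p * (deriv η p.1 * θ p.2) := by
    have hcs := (hasCompactSupport_prod_mul hηc.deriv hθc).mul_left (f := u)
    refine Continuous.integrable_of_hasCompactSupport ?_ hcs
    have := hθ.continuous
    fun_prop
  have h2 : Integrable fun p : Plane => v p * (η p.1 * θ p.2) := by
    obtain ⟨C, hC⟩ := hθc.exists_bound_of_continuous hθ.continuous
    have := hvη.mul_bdd (hθ.continuous.comp continuous_snd).aestronglyMeasurable
      (Eventually.of_forall fun p => hC p.2)
    simpa only [mul_assoc, Function.comp_apply] using this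
  have hH := H η θ hη hθ hs hθs
  rw [Measure.volume_eq_prod] at hH h1 h2
  rw [integral_prod_symm _ h1, integral_prod_symm _ h2] at hH
  have e1 : ∀ y, ∫ x, u (x, y) * (deriv η x * θ y) = θ y * ∫ x, u (x, y) * deriv η x := fun y => by
    rw [← integral_const_mul]; congr 1; ext x; ring
  have e2 : ∀ y, ∫ x, v (x, y) * (η x * θ y) = θ y * ∫ x, v (x, y) * η x := fun y => by
    rw [← integral_const_mul]; congr 1; ext x; ring
  simp only [e1, e2] at hH
  have i1 := h1.integral_prod_right
  have i2 := h2.integral_prod_right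
  simp only [e1, e2] at i1 i2
  simp only [smul_eq_mul, mul_add]
  rw [integral_add i1 i2, hH, neg_add_cancel]

lemma exists_tsupport_smoothPlateau_subset {a b r s : ℝ} (hr : a < r) (hrs : r ≤ s) (hs : s < b) :
    ∀ᶠ n : ℕ in atTop, tsupport (smoothPlateau n r s) ⊆ Ioo a b := by
  have h : Tendsto (fun n : ℕ => s + 1 / (n : ℝ)) atTop (𝓝 (s + 0)) :=
    tendsto_const_nhds.add tendsto_one_div_atTop_nhds_zero_nat
  rw [add_zero] at h
  filter_upwards [h.eventually_lt_const hs, eventually_gt_atTop 0] with n hn hn0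
  exact (tsupport_smoothPlateau_subset hn0 hrs).trans (Icc_subset_Ioo hr hn)

/-- The exceptional null set of lines depends on the test function, so only countably many endpoints
can be treated at once. Rational ones suffice by density and continuity. -/
lemma eqOn_Icc_of_forall_rat {D : ℝ → ℝ} {a b : ℝ} (hab : a < b)
    (hD : ContinuousOn D (Icc a b))
    (h : ∀ r s : ℚ, a < r → (r : ℝ) ≤ s → (s : ℝ) < b → D r = D s) :
    ∀ r ∈ Icc a b, ∀ s ∈ Icc a b, D r = D s := by
  obtain ⟨q, hq1, hq2⟩ := exists_rat_btwn hab
  have hEq : EqOn D (fun _ => D q) (Ioo a b ∩ range ((↑) : ℚ → ℝ)) := by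
    rintro _ ⟨⟨h1, h2⟩, r, rfl⟩
    rcases le_total r q with hrq | hrq
    · exact h r q h1 (by exact_mod_cast hrq) hq2
    · exact (h q r hq1 (by exact_mod_cast hrq) h2).symm
  have hcl : Icc a b ⊆ closure (Ioo a b ∩ range ((↑) : ℚ → ℝ)) := by
    rw [← closure_Ioo hab.ne]
    exact closure_minimal (Rat.denseRange_cast.open_subset_closure_inter isOpen_Ioo)
      isClosed_closure
  have hsub : Ioo a b ∩ range ((↑) : ℚ → ℝ) ⊆ Icc a b := fun x hx => Ioo_subset_Icc_self hx.1
  have := hEq.of_subset_closure hD continuousOn_const hsub hcl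
  intro r hr s hs
  rw [this hr, this hs]

/-- On almost every horizontal line a continuous function is an indefinite integral of its weak
`x`-derivative. -/
lemma ae_sub_eq_integral {u v : Plane → ℝ} (hu : Continuous u) (hv : Integrable v)
    {a b c d : ℝ} (hab : a < b)
    (H : ∀ η θ : ℝ → ℝ, ContDiff ℝ ∞ η → ContDiff ℝ ∞ θ → tsupport η ⊆ Ioo a b →
      tsupport θ ⊆ Ioo c d →
      ∫ p, u p * (deriv η p.1 * θ p.2) = -∫ p, v p * (η p.1 * θ p.2)) :
    ∀ᵐ y, y ∈ Ioo c d → Integrable (fun x => v (x, y)) ∧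
      ∀ r ∈ Icc a b, ∀ s ∈ Icc a b, u (s, y) - u (r, y) = ∫ x in r..s, v (x, y) := by
  -- The triples `(r, s, n)` are countable, so one null set of lines serves all of them.
  have hall : ∀ᵐ y, ∀ r s : ℚ, ∀ n : ℕ, tsupport (smoothPlateau n r s) ⊆ Ioo a b → y ∈ Ioo c d →
      ∫ x, u (x, y) * deriv (smoothPlateau n r s) x = -∫ x, v (x, y) * smoothPlateau n r s x := by
    rw [ae_all_iff]; intro r
    rw [ae_all_iff]; intro s
    rw [ae_all_iff]; intro n
    by_cases hs : tsupport (smoothPlateau n r s) ⊆ Ioo a b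
    · filter_upwards [ae_integral_mul_deriv_eq hu hv H (contDiff_smoothPlateau n r s) hs]
        with y hy _ using hy
    · exact Eventually.of_forall fun y h => absurd h hs
  filter_upwards [hall, Integrable.prod_left_ae hv] with y hy hvy hyc
  refine ⟨hvy, ?_⟩
  have hk : Continuous fun x => u (x, y) := by fun_prop
  -- The claim is that `u(·, y)` minus the primitive of its weak derivative is constant on the line.
  have hD : Continuous fun x => u (x, y) - ∫ t in a..x, v (t, y) :=
    hk.sub (intervalIntegral.continuous_primitive (fun _ _ => hvy.intervalIntegrable) a)
  have h := eqOn_Icc_of_forall_rat (D := fun x => u (x, y) - ∫ t in a..x, v (t, y)) hab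
    hD.continuousOn (fun r s hr hrs hs => ?_)
  · intro r hr s hs
    have h1 := h r hr s hs
    have h2 := intervalIntegral.integral_interval_sub_left
      (hvy.intervalIntegrable (a := a) (b := s)) (hvy.intervalIntegrable (a := a) (b := r))
    linarith
  · have h1 := sub_eq_integral_of_forall_smoothPlateau hk hvy hrs (by
      filter_upwards [exists_tsupport_smoothPlateau_subset hr hrs hs] with n hn
      exact hy r s n hn hyc)
    have h2 := intervalIntegral.integral_interval_sub_left
      (hvy.intervalIntegrable (a := a) (b := s)) (hvy.intervalIntegrable (a := a) (b := r))
    linarith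

lemma absolutelyContinuousOnInterval_congr {f g : ℝ → ℝ} {a b : ℝ}
    (hf : AbsolutelyContinuousOnInterval f a b) (h : EqOn f g (uIcc a b)) :
    AbsolutelyContinuousOnInterval g a b := by
  rw [absolutelyContinuousOnInterval_iff] at hf ⊢
  intro ε hε
  obtain ⟨δ, hδ, h'⟩ := hf ε hε
  refine ⟨δ, hδ, fun E hE hE2 => ?_⟩
  convert h' E hE hE2 using 1
  refine Finset.sum_congr rfl fun i hi => ?_
  rw [h (hE.1 i hi).1, h (hE.1 i hi).2]

lemma measurable_partialX {u : Plane → ℝ} (hu : Continuous u) : Measurable (partialX u) := by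
  have := measurable_deriv_with_param (𝕜 := ℝ) (f := fun y x => u (x, y)) (by fun_prop)
  exact this.comp measurable_swap

/-- A continuous function is absolutely continuous on almost every horizontal line, and its
classical `x`-derivative is integrable, if its weak `x`-derivative is integrable. -/
lemma ae_absolutelyContinuous_and_integrable {u v : Plane → ℝ} (hu : Continuous u)
    (hv : Integrable v) {a b c d : ℝ} (hab : a < b)
    (H : ∀ η θ : ℝ → ℝ, ContDiff ℝ ∞ η → ContDiff ℝ ∞ θ → tsupport η ⊆ Ioo a b →
      tsupport θ ⊆ Ioo c d →
      ∫ p, u p * (deriv η p.1 * θ p.2) = -∫ p, v p * (η p.1 * θ p.2)) :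
    (∀ᵐ y, y ∈ Ioo c d → AbsolutelyContinuousOnInterval (fun x => u (x, y)) a b) ∧
      IntegrableOn (partialX u) (Ioo a b ×ˢ Ioo c d) := by
  have hline := ae_sub_eq_integral hu hv hab H
  constructor
  · filter_upwards [hline] with y hy hyc
    obtain ⟨hvy, h⟩ := hy hyc
    have hac := (hvy.intervalIntegrable
      (a := a) (b := b)).absolutelyContinuousOnInterval_intervalIntegral (c := a) left_mem_uIcc
    have hlip : AbsolutelyContinuousOnInterval (fun _ : ℝ => u (a, y)) a b :=
      (LipschitzWith.const (u (a, y))).lipschitzOnWith.absolutelyContinuousOnInterval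
    refine absolutelyContinuousOnInterval_congr (hac.fun_add hlip) fun x hx => ?_
    rw [uIcc_of_le hab.le] at hx
    rw [← h a (left_mem_Icc.2 hab.le) x hx, sub_add_cancel]
  · have hmeas : Measurable (partialX u) := measurable_partialX hu
    -- A measurable representative is needed because Fubini's theorem for null sets, used to return
    -- from lines to the plane, asks for a measurable set.
    set w := hv.1.mk v with hw
    have hwm : Measurable w := hv.1.stronglyMeasurable_mk.measurable
    have hvw : v =ᵐ[volume] w := hv.1.ae_eq_mk
    have hvw2 : ∀ᵐ y : ℝ, ∀ᵐ x : ℝ, v (x, y) = w (x, y) := by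
      have : ∀ᵐ p : ℝ × ℝ ∂(volume.prod volume), v p.swap = w p.swap :=
        (Measure.measurePreserving_swap (μ := (volume : Measure ℝ))
          (ν := (volume : Measure ℝ))).quasiMeasurePreserving.ae hvw
      exact Measure.ae_ae_of_ae_prod this
    have hae : ∀ᵐ y, ∀ᵐ x, y ∈ Ioo c d → x ∈ Ioo a b → partialX u (x, y) = w (x, y) := by
      filter_upwards [hline, hvw2] with y hy hvwy
      by_cases hyc : y ∈ Ioo c d
      swap
      · exact Eventually.of_forall fun x h => absurd h hyc
      obtain ⟨hvy, h⟩ := hy hyc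
      filter_upwards [hvwy, (hvy.intervalIntegrable (a := a) (b := b)).ae_hasDerivAt_integral]
        with x hx1 hx2 _ hx
      rw [uIcc_of_le hab.le] at hx2
      have h3 := (hx2 (Ioo_subset_Icc_self hx) a (left_mem_Icc.2 hab.le)).add_const (u (a, y))
      have h4 : HasDerivAt (fun s => u (s, y)) (v (x, y)) x := by
        refine h3.congr_of_eventuallyEq ?_
        filter_upwards [Ioo_mem_nhds hx.1 hx.2] with z hz
        rw [← h a (left_mem_Icc.2 hab.le) z (Ioo_subset_Icc_self hz)]; ring
      rw [← hx1]
      exact h4.deriv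
    have hset : MeasurableSet {p : ℝ × ℝ | p.1 ∈ Ioo c d → p.2 ∈ Ioo a b →
        partialX u p.swap = w p.swap} := by
      have e : {p : ℝ × ℝ | p.1 ∈ Ioo c d → p.2 ∈ Ioo a b → partialX u p.swap = w p.swap} =
          (Ioo c d ×ˢ Ioo a b)ᶜ ∪ {p | partialX u p.swap = w p.swap} := by
        ext p; simp only [mem_ofPred_eq, mem_union, mem_compl_iff, mem_prod]; tauto
      rw [e]
      exact (measurableSet_Ioo.prod measurableSet_Ioo).compl.union
        (measurableSet_eq_fun (hmeas.comp measurable_swap) (hwm.comp measurable_swap))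
    have hae2 : ∀ᵐ p : ℝ × ℝ ∂(volume.prod volume), p.1 ∈ Ioo c d → p.2 ∈ Ioo a b →
        partialX u p.swap = w p.swap := (Measure.ae_prod_iff_ae_ae hset).2 hae
    have hae3 : ∀ᵐ p : ℝ × ℝ ∂(volume.prod volume), p.2 ∈ Ioo c d → p.1 ∈ Ioo a b →
        partialX u p = w p := by
      have := (Measure.measurePreserving_swap (μ := (volume : Measure ℝ))
          (ν := (volume : Measure ℝ))).quasiMeasurePreserving.ae hae2
      simpa using this
    refine (hv.integrableOn (s := Ioo a b ×ˢ Ioo c d)).congr ?_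
    rw [EventuallyEq, ae_restrict_iff' (measurableSet_Ioo.prod measurableSet_Ioo)]
    filter_upwards [hvw, hae3] with p h1 h2 hp
    rw [h1, h2 hp.2 hp.1]

/-! ### From weak derivatives on open sets to closed boxes -/

/-- Every closed box in an open set can be enlarged slightly, with a relatively compact open
neighbourhood of the larger box still inside the open set. -/
lemma exists_larger_box {Ω : Set Plane} (hΩ : IsOpen Ω) {a b c d : ℝ}
    (hbox : Icc a b ×ˢ Icc c d ⊆ Ω) (hab : a ≤ b) (hcd : c ≤ d) :
    ∃ δ > 0, ∃ U : Set Plane, IsOpen U ∧ IsCompact (closure U) ∧ closure U ⊆ Ω ∧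
      Icc (a - δ) (b + δ) ×ˢ Icc (c - δ) (d + δ) ⊆ U := by
  have hK : IsCompact (Icc a b ×ˢ Icc c d) := isCompact_Icc.prod isCompact_Icc
  obtain ⟨δ, hδ, hsub⟩ := hK.exists_cthickening_subset_open hΩ hbox
  have hcl := Metric.closure_thickening_subset_cthickening δ (Icc a b ×ˢ Icc c d)
  refine ⟨δ / 2, by positivity, Metric.thickening δ (Icc a b ×ˢ Icc c d),
    Metric.isOpen_thickening, (hK.cthickening (r := δ)).of_isClosed_subset isClosed_closure hcl,
    hcl.trans hsub, ?_⟩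
  have hclamp : ∀ {a b t : ℝ}, a ≤ b → t ∈ Icc (a - δ / 2) (b + δ / 2) →
      ∃ s ∈ Icc a b, dist t s ≤ δ / 2 := by
    intro a b t hab ht
    rcases lt_or_ge t a with h | h
    · refine ⟨a, left_mem_Icc.2 hab, ?_⟩
      rw [Real.dist_eq, abs_le]
      constructor <;> linarith [ht.1]
    rcases lt_or_ge b t with h' | h'
    · refine ⟨b, right_mem_Icc.2 hab, ?_⟩
      rw [Real.dist_eq, abs_le]
      constructor <;> linarith [ht.2]
    · exact ⟨t, ⟨h, h'⟩, by rw [dist_self]; positivity⟩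
  rintro ⟨x, y⟩ ⟨hx, hy⟩
  obtain ⟨s, hs, hxs⟩ := hclamp hab hx
  obtain ⟨t, ht, hyt⟩ := hclamp hcd hy
  refine Metric.mem_thickening_iff.2 ⟨(s, t), ⟨hs, ht⟩, ?_⟩
  rw [Prod.dist_eq]
  exact max_lt (by simp only; linarith) (by simp only; linarith)

/-- A function with a weak derivative agrees on a box with a globally continuous function which
has an integrable weak derivative there. -/
lemma HasWeakDeriv.exists_extension {U : Set Plane} {e : Plane} {u v : Plane → ℝ}
    (h : HasWeakDeriv U e u v) (hu : ContinuousOn u U) {a b c d : ℝ} (hab : a ≤ b) (hcd : c ≤ d)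
    (hbox : Icc a b ×ˢ Icc c d ⊆ U) :
    ∃ u' v' : Plane → ℝ, Continuous u' ∧ Integrable v' ∧ EqOn u' u (Icc a b ×ˢ Icc c d) ∧
      ∀ φ : Plane → ℝ, ContDiff ℝ ∞ φ → tsupport φ ⊆ Ioo a b ×ˢ Ioo c d →
        ∫ p, u' p * fderiv ℝ φ p e = -∫ p, v' p * φ p := by
  have hK : IsCompact (Icc a b ×ˢ Icc c d) := isCompact_Icc.prod isCompact_Icc
  have hm : MeasurableSet (Icc a b ×ˢ Icc c d) := measurableSet_Icc.prod measurableSet_Icc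
  -- Clamping both coordinates to the box extends `u` continuously to the whole plane; `v` is cut
  -- off to the box. Test functions supported inside do not see the change.
  refine ⟨fun p => u (projIcc a b hab p.1, projIcc c d hcd p.2),
    (Icc a b ×ˢ Icc c d).indicator v, ?_, ?_, ?_, ?_⟩
  · refine (hu.mono hbox).comp_continuous ?_ fun p => ⟨Subtype.prop _, Subtype.prop _⟩
    exact (continuous_subtype_val.comp (continuous_projIcc.comp continuous_fst)).prodMk
      (continuous_subtype_val.comp (continuous_projIcc.comp continuous_snd))
  · exact (h.2.1.integrableOn_compact_subset hbox hK).integrable_indicator hm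
  · rintro ⟨x, y⟩ ⟨hx, hy⟩
    simp only [projIcc_of_mem hab hx, projIcc_of_mem hcd hy]
  · intro φ hφ hs
    have hs' : tsupport φ ⊆ Icc a b ×ˢ Icc c d :=
      hs.trans (prod_mono Ioo_subset_Icc_self Ioo_subset_Icc_self)
    have key := h.2.2 φ hφ (hK.of_isClosed_subset (isClosed_tsupport φ) hs') (hs'.trans hbox)
    have z1 : ∀ p, p ∉ tsupport φ → fderiv ℝ φ p e = 0 := fun p hp => by
      rw [image_eq_zero_of_notMem_tsupport fun h' => hp (tsupport_fderiv_subset ℝ h')]; rfl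
    rw [setIntegral_eq_integral_of_forall_compl_eq_zero,
      setIntegral_eq_integral_of_forall_compl_eq_zero] at key
    · convert key using 3
      · rename_i p
        by_cases hp : p ∈ tsupport φ
        · obtain ⟨hx, hy⟩ := hs' hp
          simp only [projIcc_of_mem hab hx, projIcc_of_mem hcd hy]
        · rw [z1 p hp, mul_zero, mul_zero]
      · ext p
        by_cases hp : p ∈ tsupport φ
        · rw [indicator_of_mem (hs' hp)]
        · rw [image_eq_zero_of_notMem_tsupport hp, mul_zero, mul_zero]
    · intro p hp
      rw [image_eq_zero_of_notMem_tsupport fun h' => hp (hbox (hs' h')), mul_zero]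
    · intro p hp
      rw [z1 p fun h' => hp (hbox (hs' h')), mul_zero]

lemma tsupport_prod_mul_subset {ζ θ : ℝ → ℝ} :
    tsupport (fun p : Plane => ζ p.1 * θ p.2) ⊆ tsupport ζ ×ˢ tsupport θ := by
  refine closure_minimal (fun p hp => ?_) ((isClosed_tsupport ζ).prod (isClosed_tsupport θ))
  have hp : ζ p.1 * θ p.2 ≠ 0 := hp
  exact ⟨subset_tsupport ζ (left_ne_zero_of_mul hp), subset_tsupport θ (right_ne_zero_of_mul hp)⟩

lemma fderiv_prod_mul {η θ : ℝ → ℝ} (hη : ContDiff ℝ ∞ η) (hθ : ContDiff ℝ ∞ θ) (p e : Plane) :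
    fderiv ℝ (fun p : Plane => η p.1 * θ p.2) p e =
      deriv η p.1 * θ p.2 * e.1 + η p.1 * deriv θ p.2 * e.2 := by
  have h1 : HasFDerivAt (fun p : Plane => η p.1) _ p :=
    ((hη.differentiable (by simp) p.1).hasDerivAt).comp_hasFDerivAt p
      (hasFDerivAt_fst (𝕜 := ℝ) (E := ℝ) (F := ℝ) (p := p))
  have h2 : HasFDerivAt (fun p : Plane => θ p.2) _ p :=
    ((hθ.differentiable (by simp) p.2).hasDerivAt).comp_hasFDerivAt p
      (hasFDerivAt_snd (𝕜 := ℝ) (E := ℝ) (F := ℝ) (p := p))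
  rw [(h1.fun_mul h2).fderiv]
  simp
  ring

lemma contDiff_prod_mul {η θ : ℝ → ℝ} (hη : ContDiff ℝ ∞ η) (hθ : ContDiff ℝ ∞ θ) :
    ContDiff ℝ ∞ fun p : Plane => η p.1 * θ p.2 :=
  (hη.comp contDiff_fst).mul (hθ.comp contDiff_snd)

lemma partialX_eq_of_eqOn {u w : Plane → ℝ} {a b c d : ℝ}
    (h : EqOn w u (Icc a b ×ˢ Icc c d)) {p : Plane} (h1 : p.1 ∈ Ioo a b) (h2 : p.2 ∈ Icc c d) :
    partialX w p = partialX u p := by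
  refine EventuallyEq.deriv_eq ?_
  filter_upwards [Ioo_mem_nhds h1.1 h1.2] with s hs using h ⟨Ioo_subset_Icc_self hs, h2⟩

/-- `u` is absolutely continuous on almost every horizontal segment of each closed box in `Ω`, and
its classical `x`-derivative is locally integrable. -/
structure IsACLX (Ω : Set Plane) (u : Plane → ℝ) : Prop where
  continuousOn : ContinuousOn u Ω
  ae_absolutelyContinuous : ∀ a b c d : ℝ, a ≤ b → c ≤ d → Icc a b ×ˢ Icc c d ⊆ Ω →
    ∀ᵐ y, y ∈ Icc c d → AbsolutelyContinuousOnInterval (fun x => u (x, y)) a b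
  integrableOn : ∀ a b c d : ℝ, a ≤ b → c ≤ d → Icc a b ×ˢ Icc c d ⊆ Ω →
    IntegrableOn (partialX u) (Icc a b ×ˢ Icc c d)

/-- Weak derivatives give information in the interior of a box only. Working in a slightly larger
box covers the boundary of the given one, and also degenerate boxes. -/
lemma isACLX_of_hasWeakDeriv {Ω : Set Plane} (hΩ : IsOpen Ω) {u : Plane → ℝ}
    (hu : ContinuousOn u Ω)
    (hw : ∀ U : Set Plane, IsOpen U → IsCompact (closure U) → closure U ⊆ Ω →
      ∃ v, HasWeakDeriv U (1, 0) u v) : IsACLX Ω u := by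
  have main : ∀ a b c d : ℝ, a ≤ b → c ≤ d → Icc a b ×ˢ Icc c d ⊆ Ω →
      (∀ᵐ y, y ∈ Icc c d → AbsolutelyContinuousOnInterval (fun x => u (x, y)) a b) ∧
      IntegrableOn (partialX u) (Icc a b ×ˢ Icc c d) := by
    intro a b c d hab hcd hbox
    obtain ⟨δ, hδ, U, hU, hUc, hUΩ, hbU⟩ := exists_larger_box hΩ hbox hab hcd
    obtain ⟨v, hv⟩ := hw U hU hUc hUΩ
    obtain ⟨u', v', hu', hv', heq, H⟩ := hv.exists_extension
      (hu.mono (subset_closure.trans hUΩ)) (by linarith) (by linarith) hbU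
    obtain ⟨hac, hint⟩ := ae_absolutelyContinuous_and_integrable hu' hv'
      (show a - δ < b + δ by linarith) (c := c - δ) (d := d + δ) (fun η θ hη hθ hηs hθs => by
        have := H _ (contDiff_prod_mul hη hθ)
          (tsupport_prod_mul_subset.trans (prod_mono hηs hθs))
        simpa only [fderiv_prod_mul hη hθ, mul_one, mul_zero, add_zero] using this)
    have i1 : Icc a b ⊆ Ioo (a - δ) (b + δ) := Icc_subset_Ioo (by linarith) (by linarith)
    have i2 : Icc c d ⊆ Ioo (c - δ) (d + δ) := Icc_subset_Ioo (by linarith) (by linarith)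
    constructor
    · filter_upwards [hac] with y hy hyc
      refine absolutelyContinuousOnInterval_congr ((hy (i2 hyc)).mono ?_) fun x hx => ?_
      · rw [uIcc_of_le hab, uIcc_of_le (by linarith)]
        exact i1.trans Ioo_subset_Icc_self
      · rw [uIcc_of_le hab] at hx
        exact heq ⟨Ioo_subset_Icc_self (i1 hx), Ioo_subset_Icc_self (i2 hyc)⟩
    · refine (hint.mono_set (prod_mono i1 i2)).congr_fun (fun p hp => ?_)
        (measurableSet_Icc.prod measurableSet_Icc)
      exact partialX_eq_of_eqOn heq (i1 hp.1) (Ioo_subset_Icc_self (i2 hp.2))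
  exact ⟨hu, fun a b c d h1 h2 h3 => (main a b c d h1 h2 h3).1,
    fun a b c d h1 h2 h3 => (main a b c d h1 h2 h3).2⟩

/-- Exchanging the coordinates turns the `y`-derivative into an `x`-derivative, and product test
functions into product test functions. -/
lemma isACLX_swap_of_hasWeakDeriv {Ω : Set Plane} (hΩ : IsOpen Ω) {u : Plane → ℝ}
    (hu : ContinuousOn u Ω)
    (hw : ∀ U : Set Plane, IsOpen U → IsCompact (closure U) → closure U ⊆ Ω →
      ∃ v, HasWeakDeriv U (0, 1) u v) :
    IsACLX (Prod.swap ⁻¹' Ω) (fun p => u p.swap) := by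
  have main : ∀ a b c d : ℝ, a ≤ b → c ≤ d → Icc a b ×ˢ Icc c d ⊆ Prod.swap ⁻¹' Ω →
      (∀ᵐ y, y ∈ Icc c d → AbsolutelyContinuousOnInterval (fun x => u (y, x)) a b) ∧
      IntegrableOn (partialX fun p => u p.swap) (Icc a b ×ˢ Icc c d) := by
    intro a b c d hab hcd hbox
    have hbox' : Icc c d ×ˢ Icc a b ⊆ Ω := fun p hp => hbox (a := p.swap) ⟨hp.2, hp.1⟩
    obtain ⟨δ, hδ, U, hU, hUc, hUΩ, hbU⟩ := exists_larger_box hΩ hbox' hcd hab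
    obtain ⟨v, hv⟩ := hw U hU hUc hUΩ
    obtain ⟨u', v', hu', hv', heq, H⟩ := hv.exists_extension
      (hu.mono (subset_closure.trans hUΩ)) (by linarith) (by linarith) hbU
    obtain ⟨hac, hint⟩ := ae_absolutelyContinuous_and_integrable (hu'.comp continuous_swap)
      (v := fun p => v' p.swap) (by exact hv'.swap)
      (show a - δ < b + δ by linarith) (c := c - δ) (d := d + δ) (fun η θ hη hθ hηs hθs => by
        have h := H _ (contDiff_prod_mul hθ hη)
          (tsupport_prod_mul_subset.trans (prod_mono hθs hηs))
        simp only [fderiv_prod_mul hθ hη, mul_one, mul_zero, zero_add] at h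
        have s1 := integral_prod_swap (μ := (volume : Measure ℝ)) (ν := (volume : Measure ℝ))
          fun p : Plane => u' p * (θ p.1 * deriv η p.2)
        have s2 := integral_prod_swap (μ := (volume : Measure ℝ)) (ν := (volume : Measure ℝ))
          fun p : Plane => v' p * (θ p.1 * η p.2)
        rw [Measure.volume_eq_prod] at h ⊢
        rw [← s1, ← s2] at h
        simpa only [Function.comp_apply, Prod.fst_swap, Prod.snd_swap, mul_comm (θ _)] using h)
    have i1 : Icc a b ⊆ Ioo (a - δ) (b + δ) := Icc_subset_Ioo (by linarith) (by linarith)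
    have i2 : Icc c d ⊆ Ioo (c - δ) (d + δ) := Icc_subset_Ioo (by linarith) (by linarith)
    have heq' : EqOn (u' ∘ Prod.swap) (fun p => u p.swap)
        (Icc (a - δ) (b + δ) ×ˢ Icc (c - δ) (d + δ)) := fun p hp => heq (x := p.swap) ⟨hp.2, hp.1⟩
    constructor
    · filter_upwards [hac] with y hy hyc
      refine absolutelyContinuousOnInterval_congr ((hy (i2 hyc)).mono ?_) fun x hx => ?_
      · rw [uIcc_of_le hab, uIcc_of_le (by linarith)]
        exact i1.trans Ioo_subset_Icc_self
      · rw [uIcc_of_le hab] at hx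
        exact heq' (x := (x, y)) ⟨Ioo_subset_Icc_self (i1 hx), Ioo_subset_Icc_self (i2 hyc)⟩
    · refine (hint.mono_set (prod_mono i1 i2)).congr_fun (fun p hp => ?_)
        (measurableSet_Icc.prod measurableSet_Icc)
      exact partialX_eq_of_eqOn heq' (i1 hp.1) (Ioo_subset_Icc_self (i2 hp.2))
  exact ⟨hu.comp continuous_swap.continuousOn fun p hp => hp,
    fun a b c d h1 h2 h3 => (main a b c d h1 h2 h3).1,
    fun a b c d h1 h2 h3 => (main a b c d h1 h2 h3).2⟩

/-! ### Null sets and the Cauchy-Riemann equations -/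

/-- A zero with nonzero derivative is an isolated zero, and a subset of the line has only countably
many isolated points. -/
lemma countable_setOf_eq_zero_and_deriv_ne_zero (k : ℝ → ℝ) :
    {x | k x = 0 ∧ deriv k x ≠ 0}.Countable := by
  refine (countable_setOfPred_isolated_right_within (s := {x | k x = 0})).mono ?_
  rintro x ⟨h0, hd⟩
  refine ⟨h0, ?_⟩
  have h := (differentiableAt_of_deriv_ne_zero hd).hasDerivAt.eventually_ne hd (c := 0)
  rw [← empty_mem_iff_bot]
  rw [eventually_nhdsWithin_iff] at h
  filter_upwards [nhdsWithin_le_nhds h, self_mem_nhdsWithin] with y hy hy2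
  exact hy (ne_of_gt hy2.2) hy2.1

/-- The `x`-derivative of a continuous function vanishes almost everywhere on its zero set. -/
lemma ae_partialX_eq_zero_of_continuous {u : Plane → ℝ} (hu : Continuous u) :
    ∀ᵐ p, u p = 0 → partialX u p = 0 := by
  have hset : MeasurableSet {p : ℝ × ℝ | u p.swap = 0 → partialX u p.swap = 0} := by
    have e : {p : ℝ × ℝ | u p.swap = 0 → partialX u p.swap = 0} =
        {p | u p.swap = 0}ᶜ ∪ {p | partialX u p.swap = 0} := by
      ext p; simp only [mem_ofPred_eq, mem_union, mem_compl_iff]; tauto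
    rw [e]
    exact (measurableSet_eq_fun (hu.measurable.comp measurable_swap) measurable_const).compl.union
      (measurableSet_eq_fun ((measurable_partialX hu).comp measurable_swap) measurable_const)
  have h : ∀ᵐ p : ℝ × ℝ ∂(volume.prod volume), u p.swap = 0 → partialX u p.swap = 0 := by
    refine (Measure.ae_prod_iff_ae_ae hset).2 (Eventually.of_forall fun y => ?_)
    have := (countable_setOf_eq_zero_and_deriv_ne_zero fun x => u (x, y)).ae_notMem volume
    filter_upwards [this] with x hx h0
    by_contra h1
    exact hx ⟨h0, h1⟩
  have := (Measure.measurePreserving_swap (μ := (volume : Measure ℝ))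
    (ν := (volume : Measure ℝ))).quasiMeasurePreserving.ae h
  rw [Measure.volume_eq_prod]
  simpa using this

/-- Every point of an open set has a box neighbourhood on which a given function, continuous on
the open set, extends continuously to the plane. -/
lemma exists_continuous_eqOn_box {Ω : Set Plane} (hΩ : IsOpen Ω) {u : Plane → ℝ}
    (hu : ContinuousOn u Ω) {p : Plane} (hp : p ∈ Ω) :
    ∃ V ∈ 𝓝 p, ∃ u' : Plane → ℝ, Continuous u' ∧
      ∀ q ∈ V, u' q = u q ∧ partialX u' q = partialX u q ∧ partialY u' q = partialY u q := by
  obtain ⟨δ, hδ, U, hU, -, hUΩ, hbox⟩ := exists_larger_box hΩ (a := p.1) (b := p.1) (c := p.2)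
    (d := p.2) (fun q hq => by
      have : q = p := by simpa [Prod.ext_iff] using hq
      exact this ▸ hp) le_rfl le_rfl
  have hab : p.1 - δ ≤ p.1 + δ := by linarith
  have hcd : p.2 - δ ≤ p.2 + δ := by linarith
  have heq : EqOn (fun q => u (projIcc _ _ hab q.1, projIcc _ _ hcd q.2)) u
      (Icc (p.1 - δ) (p.1 + δ) ×ˢ Icc (p.2 - δ) (p.2 + δ)) := by
    rintro ⟨x, y⟩ ⟨hx, hy⟩
    simp only [projIcc_of_mem hab hx, projIcc_of_mem hcd hy]
  refine ⟨Ioo (p.1 - δ) (p.1 + δ) ×ˢ Ioo (p.2 - δ) (p.2 + δ),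
    prod_mem_nhds (Ioo_mem_nhds (by linarith) (by linarith))
      (Ioo_mem_nhds (by linarith) (by linarith)),
    fun q => u (projIcc _ _ hab q.1, projIcc _ _ hcd q.2), ?_, ?_⟩
  · refine (hu.mono (hbox.trans (subset_closure.trans hUΩ))).comp_continuous ?_
      fun p => ⟨Subtype.prop _, Subtype.prop _⟩
    exact (continuous_subtype_val.comp (continuous_projIcc.comp continuous_fst)).prodMk
      (continuous_subtype_val.comp (continuous_projIcc.comp continuous_snd))
  · rintro q ⟨h1, h2⟩
    refine ⟨heq ⟨Ioo_subset_Icc_self h1, Ioo_subset_Icc_self h2⟩,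
      partialX_eq_of_eqOn heq h1 (Ioo_subset_Icc_self h2), ?_⟩
    refine EventuallyEq.deriv_eq ?_
    filter_upwards [Ioo_mem_nhds h2.1 h2.2] with s hs
      using heq (x := (q.1, s)) ⟨Ioo_subset_Icc_self h1, Ioo_subset_Icc_self hs⟩

/-- A locally null set in the plane is null. -/
lemma ae_of_forall_exists_nhds {Ω : Set Plane} {P : Plane → Prop}
    (h : ∀ p ∈ Ω, ∃ V ∈ 𝓝 p, ∀ᵐ q, q ∈ V → P q) : ∀ᵐ q, q ∈ Ω → P q := by
  rw [ae_iff]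
  refine measure_null_of_locally_null _ fun p hp => ?_
  simp only [mem_ofPred_eq, Classical.not_imp] at hp
  obtain ⟨V, hV, hP⟩ := h p hp.1
  rw [ae_iff] at hP
  refine ⟨V ∩ {q | ¬(q ∈ Ω → P q)}, inter_mem (mem_nhdsWithin_of_mem_nhds hV)
    self_mem_nhdsWithin, measure_mono_null (fun q hq => ?_) hP⟩
  simp only [mem_inter_iff, mem_ofPred_eq, Classical.not_imp] at hq ⊢
  exact ⟨hq.1, hq.2.2⟩

/-- The partial derivatives of a continuous function vanish almost everywhere on its zero set. -/
lemma ae_partials_eq_zero {Ω : Set Plane} (hΩ : IsOpen Ω) {u : Plane → ℝ}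
    (hu : ContinuousOn u Ω) :
    ∀ᵐ p, p ∈ Ω → u p = 0 → partialX u p = 0 ∧ partialY u p = 0 := by
  refine ae_of_forall_exists_nhds fun p hp => ?_
  obtain ⟨V, hV, u', hu', heq⟩ := exists_continuous_eqOn_box hΩ hu hp
  refine ⟨V, hV, ?_⟩
  have h1 := ae_partialX_eq_zero_of_continuous hu'
  have h2 := (Measure.measurePreserving_swap (μ := (volume : Measure ℝ))
    (ν := (volume : Measure ℝ))).quasiMeasurePreserving.ae
      (ae_partialX_eq_zero_of_continuous (hu'.comp continuous_swap))
  filter_upwards [h1, h2] with q hq1 hq2 hqV h0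
  obtain ⟨e1, e2, e3⟩ := heq q hqV
  rw [← e2, ← e3]
  exact ⟨hq1 (e1.trans h0), hq2 (e1.trans h0)⟩

/-- Where the Jacobian is positive, the first component of the map is almost nowhere zero. -/
lemma ae_fst_ne_zero {α : ℝ} {Ω : Set Plane} (hΩ : IsOpen Ω) {g : Plane → Plane}
    (hg : ContinuousOn g Ω)
    (hJ : ∀ᵐ p ∂(volume.restrict Ω), 0 < (matrixDH α g p).det) :
    ∀ᵐ p, p ∈ Ω → (g p).1 ≠ 0 := by
  rw [ae_restrict_iff' hΩ.measurableSet] at hJ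
  filter_upwards [hJ, ae_partials_eq_zero hΩ (continuous_fst.comp_continuousOn hg)]
    with p h1 h2 hp h0
  obtain ⟨e1, e2⟩ := h2 hp h0
  have := h1 hp
  simp only [Function.comp_def] at e1 e2
  simp [matrixDH, Matrix.det_fin_two, fieldX, fieldY, e1, e2] at this

lemma ae_fst_coord_ne_zero : ∀ᵐ p : Plane, p.1 ≠ 0 := by
  have h : ∀ᵐ x : ℝ, x ≠ 0 := by simp [ae_iff]
  exact Measure.quasiMeasurePreserving_fst.ae h

/-- The entries of a positive multiple of an orthogonal matrix with positive determinant satisfy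
the Cauchy-Riemann equations. -/
lemma cauchyRiemann_of_smul_orthogonal {A O : Matrix (Fin 2) (Fin 2) ℝ} {c : ℝ}
    (hO : O ∈ Matrix.orthogonalGroup (Fin 2) ℝ) (hA : A = c • O) (hdet : 0 < A.det) :
    A 0 0 = A 1 1 ∧ A 0 1 = -A 1 0 := by
  rw [Matrix.mem_orthogonalGroup_iff] at hO
  have hAA : A * A.transpose = (c ^ 2) • (1 : Matrix (Fin 2) (Fin 2) ℝ) := by
    rw [hA, Matrix.transpose_smul, Matrix.smul_mul, Matrix.mul_smul, smul_smul, ← sq]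
    congr 1
  have e00 := congrFun (congrFun hAA 0) 0
  have e01 := congrFun (congrFun hAA 0) 1
  have e11 := congrFun (congrFun hAA 1) 1
  simp only [Matrix.mul_apply, Fin.sum_univ_two, Matrix.transpose_apply, Matrix.smul_apply,
    Matrix.one_apply_eq, smul_eq_mul, mul_one, ne_eq, zero_ne_one, not_false_eq_true,
    Matrix.one_apply_ne, mul_zero] at e00 e01 e11
  rw [Matrix.det_fin_two] at hdet
  set p := A 0 0
  set q := A 0 1
  set r := A 1 0
  set s := A 1 1
  -- By Lagrange's identity the squared determinant is the product of the squared row norms minus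
  -- the squared inner product of the rows.
  have hsq : (p * s - q * r) ^ 2 = (c ^ 2) ^ 2 := by
    have : (p * s - q * r) ^ 2 = (p * p + q * q) * (r * r + s * s) - (p * r + q * s) ^ 2 := by ring
    rw [this, e00, e11, e01]; ring
  have hd : p * s - q * r = c ^ 2 := (sq_eq_sq₀ hdet.le (sq_nonneg c)).1 hsq
  -- Expanded, the left side is `2 c² - 2 det A`, which vanishes since `det A = c²`.
  have h0 : (p - s) ^ 2 + (q + r) ^ 2 = 0 := by nlinarith
  constructor <;> nlinarith [sq_nonneg (p - s), sq_nonneg (q + r)]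

/-- The Cauchy-Riemann equations of an orientation preserving conformal map. -/
lemma IsConformal.ae_cauchyRiemann {α : ℝ} {Ω Ω' : Set Plane} (hΩ : IsOpen Ω) {g : Plane → Plane}
    (h : IsConformal α Ω Ω' g) (hor : IsOrientationPreserving α Ω Ω' g) :
    ∀ᵐ p, p ∈ Ω →
      |p.1| ^ α * (|(g p).1| ^ α * partialY (fun q => (g q).1) p) =
        -partialX (fun q => (g q).2) p ∧
      |(g p).1| ^ α * partialX (fun q => (g q).1) p =
        |p.1| ^ α * partialY (fun q => (g q).2) p := by
  have hg := h.homeo.2.1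
  have hR : MeasurableSet (regularSet Ω g) := by
    have e : regularSet Ω g = Ω ∩ ((fun p : Plane => p.1 * (g p).1) ⁻¹' {0}ᶜ) := by
      ext p
      simp only [regularSet, singularSet, Set.mem_sdiff, mem_ofPred_eq, mem_inter_iff, mem_preimage,
        mem_compl_iff, mem_singleton_iff, mul_eq_zero]
      tauto
    rw [e]
    exact ((continuousOn_fst.mul (continuous_fst.comp_continuousOn hg)).isOpen_inter_preimage hΩ
      isOpen_compl_singleton).measurableSet
  have hJ := hor.2
  have hc := h.conformal_ae
  rw [ae_restrict_iff' hR] at hc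
  have hne := ae_fst_ne_zero hΩ hg hJ
  rw [ae_restrict_iff' hΩ.measurableSet] at hJ
  filter_upwards [hc, hJ, hne, ae_fst_coord_ne_zero] with p h1 h2 h3 h4 hp
  -- Conformality is assumed only on the regular set. The singular set is null: `x = 0` is a line,
  -- and `g₁ = 0` is excluded almost everywhere by the positive Jacobian.
  obtain ⟨c, hc, O, hO, hA⟩ := h1 ⟨hp, fun hs => hs.2.elim h4 (h3 hp)⟩
  have hw : 0 < |(g p).1| ^ α := Real.rpow_pos_of_pos (abs_pos.2 (h3 hp)) α
  have hdet : 0 < (matrixD α g p).det := by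
    have h2' := h2 hp
    have : (matrixD α g p).det = (matrixDH α g p).det / |(g p).1| ^ α := by
      simp only [matrixD, matrixDH, Matrix.det_fin_two_of]
      ring
    rw [this]
    positivity
  obtain ⟨e1, e2⟩ := cauchyRiemann_of_smul_orthogonal hO hA hdet
  simp only [matrixD, fieldX, fieldY, Matrix.of_apply, Matrix.cons_val_zero, Matrix.cons_val_one,
    Matrix.cons_val', Matrix.cons_val_fin_one] at e1 e2
  constructor
  · rw [← mul_assoc, mul_comm (|p.1| ^ α), mul_assoc, e2]
    field_simp
  · rw [e1]
    field_simp

/-! ### Green's formula on boxes -/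

lemma absolutelyContinuousOnInterval_comp {X Y : Type*} [PseudoMetricSpace X]
    [PseudoMetricSpace Y] {ψ : X → Y} {f : ℝ → X} {a b : ℝ} {s : Set X} {K : ℝ≥0}
    (hψ : LipschitzOnWith K ψ s) (hs : MapsTo f (uIcc a b) s)
    (hf : AbsolutelyContinuousOnInterval f a b) :
    AbsolutelyContinuousOnInterval (ψ ∘ f) a b := by
  rw [absolutelyContinuousOnInterval_iff] at hf ⊢
  intro ε hε
  obtain ⟨δ, hδ, h'⟩ := hf (ε / (K + 1)) (by positivity)
  refine ⟨δ, hδ, fun E hE hE2 => ?_⟩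
  have h1 : ∑ i ∈ Finset.range E.1, dist ((ψ ∘ f) (E.2 i).1) ((ψ ∘ f) (E.2 i).2) ≤
      K * ∑ i ∈ Finset.range E.1, dist (f (E.2 i).1) (f (E.2 i).2) := by
    rw [Finset.mul_sum]
    refine Finset.sum_le_sum fun i hi => ?_
    exact hψ.dist_le_mul _ (hs (hE.1 i hi).1) _ (hs (hE.1 i hi).2)
  have h2 := h' E hE hE2
  rw [lt_div_iff₀ (by positivity)] at h2
  have h3 : 0 ≤ ∑ i ∈ Finset.range E.1, dist (f (E.2 i).1) (f (E.2 i).2) :=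
    Finset.sum_nonneg fun i _ => dist_nonneg
  nlinarith

/-- The chain rule and the fundamental theorem of calculus along an absolutely continuous
function. -/
lemma integral_mul_deriv_of_absolutelyContinuous {f ψ ψ' : ℝ → ℝ} {a b : ℝ}
    (hf : AbsolutelyContinuousOnInterval f a b) (hψ : ∀ x, HasDerivAt ψ (ψ' x) x)
    (hψ' : Continuous ψ') :
    ∫ x in a..b, ψ' (f x) * deriv f x = ψ (f b) - ψ (f a) := by
  obtain ⟨C, hC⟩ := hf.exists_bound
  -- On the bounded range of `f` a `C¹` function is Lipschitz, so `ψ ∘ f` is again absolutely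
  -- continuous.
  have hcd : ContDiff ℝ 1 ψ := by
    rw [contDiff_one_iff_deriv]
    refine ⟨fun x => (hψ x).differentiableAt, ?_⟩
    convert hψ' using 1
    ext x
    exact (hψ x).deriv
  obtain ⟨K, hK⟩ := hcd.contDiffOn.exists_lipschitzOnWith (s := Icc (-C) C) (by decide)
    (convex_Icc _ _) isCompact_Icc
  have hac := absolutelyContinuousOnInterval_comp hK (fun x hx => abs_le.1 (hC x hx)) hf
  have h := hac.integral_deriv_eq_sub
  rw [Function.comp_apply, Function.comp_apply] at h
  rw [← h]
  refine intervalIntegral.integral_congr_ae ?_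
  filter_upwards [hf.ae_differentiableAt] with x hx hxm
  exact (((hψ (f x)).comp x (hx (uIoc_subset_uIcc hxm)).hasDerivAt).deriv).symm

/-- Fubini's theorem combined with integration along horizontal lines. -/
lemma IsACLX.integral_sub_eq {Ω : Set Plane} {u : Plane → ℝ} (hu : IsACLX Ω u)
    {ψ ψ' w : ℝ → ℝ} (hψ : ∀ x, HasDerivAt ψ (ψ' x) x) (hψ' : Continuous ψ')
    (hw : Continuous w) {a b c d : ℝ} (hab : a ≤ b) (hcd : c ≤ d)
    (hbox : Icc a b ×ˢ Icc c d ⊆ Ω) :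
    ∫ y in c..d, w y * (ψ (u (b, y)) - ψ (u (a, y))) =
      ∫ p in Icc a b ×ˢ Icc c d, w p.2 * (ψ' (u p) * partialX u p) := by
  have hK : IsCompact (Icc a b ×ˢ Icc c d) := isCompact_Icc.prod isCompact_Icc
  have hint : IntegrableOn (fun p : Plane => w p.2 * (ψ' (u p) * partialX u p))
      (Icc a b ×ˢ Icc c d) := by
    refine IntegrableOn.continuousOn_mul (hw.comp continuous_snd).continuousOn ?_ hK
    exact IntegrableOn.continuousOn_mul
      (hψ'.comp_continuousOn (hu.continuousOn.mono hbox)) (hu.integrableOn a b c d hab hcd hbox) hK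
  rw [IntegrableOn, Measure.volume_eq_prod, ← Measure.prod_restrict] at hint
  rw [Measure.volume_eq_prod, ← Measure.prod_restrict, integral_prod_symm _ hint,
    intervalIntegral.integral_of_le hcd, ← integral_Icc_eq_integral_Ioc]
  refine setIntegral_congr_ae measurableSet_Icc ?_
  filter_upwards [hu.ae_absolutelyContinuous a b c d hab hcd hbox] with y hy hyc
  rw [integral_Icc_eq_integral_Ioc, ← intervalIntegral.integral_of_le hab,
    intervalIntegral.integral_const_mul]
  exact congrArg _ (integral_mul_deriv_of_absolutelyContinuous (hy hyc) hψ hψ').symm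

lemma IsACLX.integral_sub_eq_swap {Ω : Set Plane} {u : Plane → ℝ}
    (hu : IsACLX (Prod.swap ⁻¹' Ω) fun p => u p.swap)
    {ψ ψ' w : ℝ → ℝ} (hψ : ∀ x, HasDerivAt ψ (ψ' x) x) (hψ' : Continuous ψ')
    (hw : Continuous w) {a b c d : ℝ} (hab : a ≤ b) (hcd : c ≤ d)
    (hbox : Icc a b ×ˢ Icc c d ⊆ Ω) :
    ∫ x in a..b, w x * (ψ (u (x, d)) - ψ (u (x, c))) =
      ∫ p in Icc a b ×ˢ Icc c d, w p.1 * (ψ' (u p) * partialY u p) := by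
  have h := hu.integral_sub_eq hψ hψ' hw hcd hab fun p hp => hbox (a := p.swap) ⟨hp.2, hp.1⟩
  simp only [Prod.swap_prod_mk] at h
  rw [h]
  have h2 := (Measure.measurePreserving_swap (μ := (volume : Measure ℝ))
    (ν := (volume : Measure ℝ))).setIntegral_preimage_emb
    (MeasurableEquiv.prodComm (α := ℝ) (β := ℝ)).measurableEmbedding
    (fun p : Plane => w p.1 * (ψ' (u p) * partialY u p)) (Icc a b ×ˢ Icc c d)
  rw [preimage_swap_prod] at h2
  exact h2

/-- `g` is absolutely continuous on lines and satisfies, almost everywhere, the Cauchy-Riemann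
equations of the Grushin plane. -/
structure IsWeaklyConformal (α : ℝ) (Ω : Set Plane) (g : Plane → Plane) : Prop where
  aclX₁ : IsACLX Ω fun p => (g p).1
  aclY₁ : IsACLX (Prod.swap ⁻¹' Ω) fun p => (g p.swap).1
  aclX₂ : IsACLX Ω fun p => (g p).2
  aclY₂ : IsACLX (Prod.swap ⁻¹' Ω) fun p => (g p.swap).2
  cauchyRiemann : ∀ᵐ p, p ∈ Ω →
      |p.1| ^ α * (|(g p).1| ^ α * partialY (fun q => (g q).1) p) =
        -partialX (fun q => (g q).2) p ∧
      |(g p).1| ^ α * partialX (fun q => (g q).1) p =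
        |p.1| ^ α * partialY (fun q => (g q).2) p

lemma IsConformal.isWeaklyConformal {α : ℝ} {Ω Ω' : Set Plane} (hΩ : IsOpen Ω)
    {g : Plane → Plane} (h : IsConformal α Ω Ω' g) (hor : IsOrientationPreserving α Ω Ω' g) :
    IsWeaklyConformal α Ω g := by
  have hg := h.homeo.2.1
  have hg1 := continuous_fst.comp_continuousOn hg
  have hg2 := continuous_snd.comp_continuousOn hg
  refine ⟨isACLX_of_hasWeakDeriv hΩ hg1 ?_, isACLX_swap_of_hasWeakDeriv hΩ hg1 ?_,
    isACLX_of_hasWeakDeriv hΩ hg2 ?_, isACLX_swap_of_hasWeakDeriv hΩ hg2 ?_,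
    h.ae_cauchyRiemann hΩ hor⟩
  all_goals
    intro U hU hUc hUΩ
    obtain ⟨-, ⟨-, ux, uy, hx, hy, -⟩, ⟨-, vx, vy, hx', hy', -⟩⟩ := h.sobolev.2 U hU hUc hUΩ
  exacts [⟨ux, hx⟩, ⟨uy, hy⟩, ⟨vx, hx'⟩, ⟨vy, hy'⟩]

/-- The real and imaginary parts of a contour integral around a box. -/
def BoxIntegralsVanish (α : ℝ) (g : Plane → Plane) (a b c d : ℝ) : Prop :=
  (∫ x in a..b, |x| ^ α * (powChart α (g (x, d)).1 - powChart α (g (x, c)).1)) +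
      (∫ y in c..d, ((g (b, y)).2 - (g (a, y)).2)) = 0 ∧
    (∫ y in c..d, (powChart α (g (b, y)).1 - powChart α (g (a, y)).1)) -
      (∫ x in a..b, |x| ^ α * ((g (x, d)).2 - (g (x, c)).2)) = 0

lemma BoxIntegralsVanish.symm_left {α : ℝ} {g : Plane → Plane} {a b c d : ℝ}
    (h : BoxIntegralsVanish α g a b c d) : BoxIntegralsVanish α g b a c d := by
  have e : ∀ k : Plane → ℝ, ∫ y in c..d, (k (a, y) - k (b, y)) =
      -∫ y in c..d, (k (b, y) - k (a, y)) := fun k => by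
    rw [← intervalIntegral.integral_neg]; simp only [neg_sub]
  rw [BoxIntegralsVanish, intervalIntegral.integral_symm a b, intervalIntegral.integral_symm a b,
    e fun p => (g p).2, e fun p => powChart α (g p).1]
  exact ⟨by linarith [h.1], by linarith [h.2]⟩

lemma BoxIntegralsVanish.symm_right {α : ℝ} {g : Plane → Plane} {a b c d : ℝ}
    (h : BoxIntegralsVanish α g a b c d) : BoxIntegralsVanish α g a b d c := by
  have e : ∀ k : Plane → ℝ, ∫ x in a..b, |x| ^ α * (k (x, c) - k (x, d)) =
      -∫ x in a..b, |x| ^ α * (k (x, d) - k (x, c)) := fun k => by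
    rw [← intervalIntegral.integral_neg]
    congr 1
    ext x
    ring
  rw [BoxIntegralsVanish, intervalIntegral.integral_symm c d, intervalIntegral.integral_symm c d,
    e fun p => (g p).2, e fun p => powChart α (g p).1]
  exact ⟨by linarith [h.1], by linarith [h.2]⟩

/-- Each boundary integral becomes an area integral of a partial derivative; the two area integrals
cancel by the Cauchy-Riemann equations. Integrating in `x` with weight `|x|^α` avoids
differentiating the inverse chart, so the box may cross the singular line. -/
lemma IsWeaklyConformal.boxIntegralsVanish {α : ℝ} (hα : 0 < α) {Ω : Set Plane}
    {g : Plane → Plane} (h : IsWeaklyConformal α Ω g) {a b c d : ℝ}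
    (hbox : uIcc a b ×ˢ uIcc c d ⊆ Ω) : BoxIntegralsVanish α g a b c d := by
  wlog hab : a ≤ b generalizing a b
  · exact (this (by rwa [uIcc_comm b a]) (le_of_not_ge hab)).symm_left
  wlog hcd : c ≤ d generalizing c d
  · exact (this (by rwa [uIcc_comm d c]) (le_of_not_ge hcd)).symm_right
  rw [uIcc_of_le hab, uIcc_of_le hcd] at hbox
  have hφ := hasDerivAt_powChart hα
  have hφ' := continuous_abs_rpow hα
  have hm : MeasurableSet (Icc a b ×ˢ Icc c d) := measurableSet_Icc.prod measurableSet_Icc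
  have x1 := h.aclX₁.integral_sub_eq hφ hφ' (continuous_const (y := (1 : ℝ))) hab hcd hbox
  have x2 := h.aclX₂.integral_sub_eq hasDerivAt_id continuous_const
    (continuous_const (y := (1 : ℝ))) hab hcd hbox
  have y1 := IsACLX.integral_sub_eq_swap (u := fun p => (g p).1) h.aclY₁ hφ hφ' hφ' hab hcd hbox
  have y2 := IsACLX.integral_sub_eq_swap (u := fun p => (g p).2) h.aclY₂ hasDerivAt_id
    continuous_const hφ' hab hcd hbox
  simp only [one_mul, id] at x1 x2 y1 y2
  constructor
  · rw [y1, x2, ← eq_neg_iff_add_eq_zero, ← integral_neg]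
    refine setIntegral_congr_ae hm ?_
    filter_upwards [h.cauchyRiemann] with p hp hpb using (hp (hbox hpb)).1
  · rw [x1, y2, sub_eq_zero]
    refine setIntegral_congr_ae hm ?_
    filter_upwards [h.cauchyRiemann] with p hp hpb using (hp (hbox hpb)).2

/-! ### Holomorphy in the chart by Morera's theorem -/

/-- The domain `Ω` in the coordinates in which the Grushin plane is conformal to the Euclidean
plane. -/
def chartDomain (α : ℝ) (hα : 0 < α) (Ω : Set Plane) : Set ℂ :=
  {z | ((powHomeo α hα).symm z.re, z.im) ∈ Ω}

/-- The map `g` in the coordinates in which the Grushin plane is conformal to the Euclidean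
plane. -/
noncomputable def chartMap (α : ℝ) (hα : 0 < α) (g : Plane → Plane) (z : ℂ) : ℂ :=
  ⟨powChart α (g ((powHomeo α hα).symm z.re, z.im)).1, (g ((powHomeo α hα).symm z.re, z.im)).2⟩

lemma continuous_chart_symm {α : ℝ} (hα : 0 < α) :
    Continuous fun z : ℂ => (((powHomeo α hα).symm z.re, z.im) : Plane) :=
  ((powHomeo α hα).symm.continuous.comp Complex.continuous_re).prodMk Complex.continuous_im

lemma isOpen_chartDomain {α : ℝ} (hα : 0 < α) {Ω : Set Plane} (hΩ : IsOpen Ω) :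
    IsOpen (chartDomain α hα Ω) :=
  hΩ.preimage (continuous_chart_symm hα)

lemma continuousOn_chartMap {α : ℝ} (hα : 0 < α) {Ω : Set Plane} {g : Plane → Plane}
    (hg : ContinuousOn g Ω) : ContinuousOn (chartMap α hα g) (chartDomain α hα Ω) := by
  have h : ContinuousOn (fun z : ℂ => g ((powHomeo α hα).symm z.re, z.im))
      (chartDomain α hα Ω) := hg.comp (continuous_chart_symm hα).continuousOn fun z hz => hz
  have e : chartMap α hα g = fun z => Complex.equivRealProdCLM.symm
      (powChart α (g ((powHomeo α hα).symm z.re, z.im)).1,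
        (g ((powHomeo α hα).symm z.re, z.im)).2) := rfl
  rw [e]
  exact Complex.equivRealProdCLM.symm.continuous.comp_continuousOn
    (((continuous_powChart hα).comp_continuousOn (continuous_fst.comp_continuousOn h)).prodMk
      (continuous_snd.comp_continuousOn h))

lemma intervalIntegral_re_im {f : ℝ → ℂ} {a b : ℝ} (hf : IntervalIntegrable f volume a b) :
    (∫ x in a..b, f x).re = ∫ x in a..b, (f x).re ∧
      (∫ x in a..b, f x).im = ∫ x in a..b, (f x).im :=
  ⟨(Complex.reCLM.intervalIntegral_comp_comm hf).symm,
    (Complex.imCLM.intervalIntegral_comp_comm hf).symm⟩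

/-- The substitution `u = powChart α x`, with `du = |x|^α dx`, uses only the chart, which is
differentiable everywhere, and not its inverse. -/
lemma integral_powHomeo_symm {α : ℝ} (hα : 0 < α) {k : ℝ → ℝ} {a b : ℝ}
    (hk : ContinuousOn (fun u => k ((powHomeo α hα).symm u)) (uIcc a b)) :
    ∫ u in a..b, k ((powHomeo α hα).symm u) =
      ∫ x in ((powHomeo α hα).symm a)..((powHomeo α hα).symm b), |x| ^ α * k x := by
  have h := intervalIntegral.integral_comp_mul_deriv' (a := (powHomeo α hα).symm a)
    (b := (powHomeo α hα).symm b) (f := powChart α) (g := fun u => k ((powHomeo α hα).symm u))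
    (fun x _ => hasDerivAt_powChart hα x) (continuous_abs_rpow hα).continuousOn ?_
  · rw [powChart_symm, powChart_symm] at h
    rw [← h]
    simp only [Function.comp_apply, symm_powChart, mul_comm]
  · refine hk.mono ?_
    have := (strictMono_powChart hα).monotone.image_uIcc_subset
      (a := (powHomeo α hα).symm a) (b := (powHomeo α hα).symm b)
    rwa [powChart_symm, powChart_symm] at this

/-- By Morera's theorem it is enough that the continuous map has zero integral around every
rectangle. The real and imaginary parts of that integral are, after the substitution on horizontal
sides, those of `BoxIntegralsVanish`. -/
lemma IsWeaklyConformal.differentiableOn_chartMap {α : ℝ} (hα : 0 < α) {Ω : Set Plane}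
    (hΩ : IsOpen Ω) {g : Plane → Plane} (hg : ContinuousOn g Ω) (h : IsWeaklyConformal α Ω g) :
    DifferentiableOn ℂ (chartMap α hα g) (chartDomain α hα Ω) := by
  have hc := continuousOn_chartMap hα hg
  refine (Complex.isConservativeOn_and_continuousOn_iff_isDifferentiableOn
    (isOpen_chartDomain hα hΩ)).1 ⟨fun z w hzw => ?_, hc⟩
  rw [← add_eq_zero_iff_eq_neg, Complex.wedgeIntegral_add_wedgeIntegral_eq]
  set ψ := (powHomeo α hα).symm with hψ
  have hψm : Monotone ψ := fun x y hxy => by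
    by_contra h'
    have := strictMono_powChart hα (not_le.1 h')
    rw [powChart_symm, powChart_symm] at this
    linarith
  have hx : ∀ y ∈ uIcc z.im w.im, ∀ x ∈ uIcc z.re w.re,
      ((x : ℂ) + y * Complex.I) ∈ chartDomain α hα Ω := fun y hy x hx =>
    hzw (Complex.mem_reProdIm.2 ⟨by simpa using hx, by simpa using hy⟩)
  have hH : ∀ y ∈ uIcc z.im w.im,
      ContinuousOn (fun x : ℝ => chartMap α hα g (x + y * Complex.I)) (uIcc z.re w.re) :=
    fun y hy => hc.comp (by fun_prop) fun x hx' => hx y hy x hx'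
  have hV : ∀ x ∈ uIcc z.re w.re,
      ContinuousOn (fun y : ℝ => chartMap α hα g (x + y * Complex.I)) (uIcc z.im w.im) :=
    fun x hx' => hc.comp (by fun_prop) fun y hy => hx y hy x hx'
  have hbox : uIcc (ψ z.re) (ψ w.re) ×ˢ uIcc z.im w.im ⊆ Ω := by
    rintro ⟨x, y⟩ ⟨h1, h2⟩
    have h3 := (strictMono_powChart hα).monotone.image_uIcc_subset (mem_image_of_mem _ h1)
    rw [hψ, powChart_symm, powChart_symm] at h3
    have h4 := hx y h2 _ h3
    simpa [chartDomain, symm_powChart] using h4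
  have hB := h.boxIntegralsVanish hα hbox
  have cH : ∀ (k : ℂ → ℝ), Continuous k → ∀ y ∈ uIcc z.im w.im,
      ContinuousOn (fun x : ℝ => k (chartMap α hα g (x + y * Complex.I))) (uIcc z.re w.re) :=
    fun k hk y hy => hk.comp_continuousOn (hH y hy)
  have cV : ∀ (k : ℂ → ℝ), Continuous k → ∀ x ∈ uIcc z.re w.re,
      ContinuousOn (fun y : ℝ => k (chartMap α hα g (x + y * Complex.I))) (uIcc z.im w.im) :=
    fun k hk x hx => hk.comp_continuousOn (hV x hx)
  have l1 := left_mem_uIcc (a := z.im) (b := w.im)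
  have r1 := right_mem_uIcc (a := z.im) (b := w.im)
  have l2 := left_mem_uIcc (a := z.re) (b := w.re)
  have r2 := right_mem_uIcc (a := z.re) (b := w.re)
  obtain ⟨p1, p2⟩ := intervalIntegral_re_im (hH _ l1).intervalIntegrable
  obtain ⟨p3, p4⟩ := intervalIntegral_re_im (hH _ r1).intervalIntegrable
  obtain ⟨p5, p6⟩ := intervalIntegral_re_im (hV _ l2).intervalIntegrable
  obtain ⟨p7, p8⟩ := intervalIntegral_re_im (hV _ r2).intervalIntegrable
  have sH : ∀ (k : ℂ → ℝ), Continuous k →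
      (∫ x in z.re..w.re, k (chartMap α hα g (x + w.im * Complex.I))) -
        ∫ x in z.re..w.re, k (chartMap α hα g (x + z.im * Complex.I)) =
      ∫ x in (ψ z.re)..(ψ w.re), |x| ^ α *
        (k ⟨powChart α (g (x, w.im)).1, (g (x, w.im)).2⟩ -
          k ⟨powChart α (g (x, z.im)).1, (g (x, z.im)).2⟩) := fun k hk => by
    rw [← intervalIntegral.integral_sub (cH k hk _ r1).intervalIntegrable
      (cH k hk _ l1).intervalIntegrable, hψ, ← integral_powHomeo_symm hα]
    · simp [chartMap]
    · simpa [chartMap] using (cH k hk _ r1).fun_sub (cH k hk _ l1)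
  have sV : ∀ (k : ℂ → ℝ), Continuous k →
      (∫ y in z.im..w.im, k (chartMap α hα g (w.re + y * Complex.I))) -
        ∫ y in z.im..w.im, k (chartMap α hα g (z.re + y * Complex.I)) =
      ∫ y in z.im..w.im,
        (k ⟨powChart α (g (ψ w.re, y)).1, (g (ψ w.re, y)).2⟩ -
          k ⟨powChart α (g (ψ z.re, y)).1, (g (ψ z.re, y)).2⟩) := fun k hk => by
    rw [← intervalIntegral.integral_sub (cV k hk _ r2).intervalIntegrable
      (cV k hk _ l2).intervalIntegrable]
    simp [chartMap, hψ]
  have q1 := sH Complex.re Complex.continuous_re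
  have q2 := sH Complex.im Complex.continuous_im
  have q3 := sV Complex.re Complex.continuous_re
  have q4 := sV Complex.im Complex.continuous_im
  obtain ⟨b1, b2⟩ := hB
  apply Complex.ext
  · simp only [Complex.add_re, Complex.sub_re, smul_eq_mul, Complex.mul_re, Complex.I_re,
      Complex.I_im, Complex.zero_re, p1, p3, p6, p8]
    linarith
  · simp only [Complex.add_im, Complex.sub_im, smul_eq_mul, Complex.mul_im, Complex.I_re,
      Complex.I_im, Complex.zero_im, p2, p4, p5, p7]
    linarith

/-! ### Injective holomorphic functions -/

/-- An analytic function not vanishing at a point has analytic roots near that point. -/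
lemma exists_analyticAt_pow_eq {G : ℂ → ℂ} {z₀ : ℂ} (hG : AnalyticAt ℂ G z₀) (h0 : G z₀ ≠ 0)
    {n : ℕ} (hn : n ≠ 0) :
    ∃ R : ℂ → ℂ, AnalyticAt ℂ R z₀ ∧ R z₀ ≠ 0 ∧ ∀ᶠ z in 𝓝 z₀, R z ^ n = G z := by
  have hn' : (n : ℂ) ≠ 0 := Nat.cast_ne_zero.2 hn
  -- After division by `G z₀` the logarithm is taken near `1`, inside the slit plane.
  have hdiv : AnalyticAt ℂ (fun z => G z / G z₀) z₀ := hG.div analyticAt_const h0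
  refine ⟨fun z => Complex.exp (Complex.log (G z₀) / n) *
    Complex.exp (Complex.log (G z / G z₀) / n), ?_, ?_, ?_⟩
  · refine analyticAt_const.mul (AnalyticAt.cexp' ((hdiv.clog ?_).div analyticAt_const hn'))
    rw [div_self h0]
    exact Complex.one_mem_slitPlane
  · exact mul_ne_zero (Complex.exp_ne_zero _) (Complex.exp_ne_zero _)
  · filter_upwards [hG.continuousAt.eventually_ne h0] with z hz
    rw [mul_pow, ← Complex.exp_nat_mul, ← Complex.exp_nat_mul, mul_div_cancel₀ _ hn',
      mul_div_cancel₀ _ hn', Complex.exp_log h0, Complex.exp_log (div_ne_zero hz h0),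
      mul_div_cancel₀ _ h0]

/-- The derivative of an injective holomorphic function does not vanish. -/
lemma deriv_ne_zero_of_injOn {f : ℂ → ℂ} {U : Set ℂ} (hU : IsOpen U)
    (hf : DifferentiableOn ℂ f U) (hinj : InjOn f U) {z₀ : ℂ} (hz₀ : z₀ ∈ U) :
    deriv f z₀ ≠ 0 := by
  intro hd
  have hUn := hU.mem_nhds hz₀
  have hfa : AnalyticAt ℂ f z₀ := hf.analyticAt hUn
  have hfs : AnalyticAt ℂ (fun z => f z - f z₀) z₀ := hfa.sub analyticAt_const
  -- Infinite order would make `f` constant near `z₀`, against injectivity.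
  have htop : analyticOrderAt (fun z => f z - f z₀) z₀ ≠ ⊤ := fun h => by
    rw [analyticOrderAt_eq_top] at h
    have h2 : ∀ᶠ z in 𝓝[≠] z₀, False := by
      filter_upwards [nhdsWithin_le_nhds h, nhdsWithin_le_nhds hUn, self_mem_nhdsWithin]
        with z h1 h2 h3
      exact h3 (hinj h2 hz₀ (sub_eq_zero.1 h1))
    exact h2.exists.elim fun _ h => h
  obtain ⟨n, hn⟩ := ENat.ne_top_iff_exists.1 htop
  obtain ⟨G, hG, hG0, hfG⟩ := hfs.analyticOrderAt_eq_natCast.1 hn.symm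
  have hn0 : n ≠ 0 := by
    rintro rfl
    have := hfG.self_of_nhds
    simp at this
    exact hG0 this.symm
  obtain ⟨R, hR, hR0, hRG⟩ := exists_analyticAt_pow_eq hG hG0 hn0
  have hw : AnalyticAt ℂ (fun z => (z - z₀) * R z) z₀ :=
    (analyticAt_id.sub analyticAt_const).mul hR
  have hwd : HasDerivAt (fun z => (z - z₀) * R z) (R z₀) z₀ := by
    have := ((hasDerivAt_id z₀).sub_const z₀).fun_mul hR.differentiableAt.hasDerivAt
    simpa using this
  -- With `n` the order of vanishing and `R` an `n`-th root of the nonvanishing factor, `f - f z₀`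
  -- is the `n`-th power of the local coordinate `w = (z - z₀) R z`.
  have hfw : ∀ᶠ z in 𝓝 z₀, f z = f z₀ + ((z - z₀) * R z) ^ n := by
    filter_upwards [hfG, hRG] with z h1 h2
    rw [mul_pow, h2, ← smul_eq_mul, ← h1]; ring
  have hn1 : n ≠ 1 := by
    rintro rfl
    have h1 : HasDerivAt f (R z₀) z₀ := by
      refine (hwd.const_add (f z₀)).congr_of_eventuallyEq ?_
      filter_upwards [hfw] with z hz
      rw [hz, pow_one]
    exact hR0 (h1.deriv.symm.trans hd)
  have hstrict : HasStrictDerivAt (fun z => (z - z₀) * R z) (R z₀) z₀ := by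
    have := hw.hasStrictDerivAt
    rwa [hwd.deriv] at this
  have hmap := hstrict.map_nhds_eq hR0
  rw [sub_self, zero_mul] at hmap
  have himg : (fun z => (z - z₀) * R z) '' {z | z ∈ U ∧ f z = f z₀ + ((z - z₀) * R z) ^ n} ∈
      𝓝 (0 : ℂ) := by
    rw [← hmap]
    exact image_mem_map (hfw.and hUn |>.mono fun z hz => ⟨hz.2, hz.1⟩)
  -- Since `n ≥ 2` there is a root of unity `ζ ≠ 1`. For small `w ≠ 0` both `w` and `ζ w` are values
  -- of the local coordinate, at points where `f` agrees, which contradicts injectivity.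
  obtain ⟨ζ, hζ, hζ1⟩ : ∃ ζ : ℂ, ζ ^ n = 1 ∧ ζ ≠ 1 :=
    ⟨_, (Complex.isPrimitiveRoot_exp n hn0).pow_eq_one,
      (Complex.isPrimitiveRoot_exp n hn0).ne_one (by omega)⟩
  have himg2 : (fun z : ℂ => ζ * z) ⁻¹' ((fun z => (z - z₀) * R z) ''
      {z | z ∈ U ∧ f z = f z₀ + ((z - z₀) * R z) ^ n}) ∈ 𝓝 (0 : ℂ) := by
    refine (by fun_prop : Continuous fun z : ℂ => ζ * z).continuousAt.preimage_mem_nhds ?_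
    rwa [mul_zero]
  have hev := nhdsWithin_le_nhds (a := (0 : ℂ)) (s := {0}ᶜ) (inter_mem himg himg2)
  obtain ⟨w, ⟨⟨x, ⟨hxU, hx⟩, hxw⟩, ⟨y, ⟨hyU, hy⟩, hyw⟩⟩, hw0⟩ :=
    (inter_mem hev self_mem_nhdsWithin : _ ∈ 𝓝[≠] (0 : ℂ)) |> Filter.nonempty_of_mem
  simp only at hxw hyw
  have hxy : f x = f y := by rw [hx, hy, hxw, hyw, mul_pow, hζ, one_mul]
  have := hinj hxU hyU hxy
  subst this
  have h3 : (ζ - 1) * w = 0 := by rw [sub_mul, one_mul, ← hyw, hxw, sub_self]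
  rcases mul_eq_zero.1 h3 with h | h
  · exact hζ1 (sub_eq_zero.1 h)
  · exact hw0 h

/-! ### The chart derivative and invariance of the singular line -/

/-- The point of the complex plane with chart coordinates of `p`. -/
noncomputable def chartPoint (α : ℝ) (p : Plane) : ℂ := ⟨powChart α p.1, p.2⟩

lemma chartPoint_mem {α : ℝ} {hα : 0 < α} {Ω : Set Plane} {p : Plane} :
    chartPoint α p ∈ chartDomain α hα Ω ↔ p ∈ Ω := by
  simp [chartPoint, chartDomain, symm_powChart]

lemma chartMap_chartPoint {α : ℝ} (hα : 0 < α) (g : Plane → Plane) (p : Plane) :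
    chartMap α hα g (chartPoint α p) = chartPoint α (g p) := by
  simp [chartPoint, chartMap, symm_powChart]

lemma continuous_chartPoint {α : ℝ} (hα : 0 < α) : Continuous (chartPoint α) :=
  Complex.equivRealProdCLM.symm.continuous.comp
    (((continuous_powChart hα).comp continuous_fst).prodMk continuous_snd)

lemma injOn_chartMap {α : ℝ} (hα : 0 < α) {Ω : Set Plane} {g : Plane → Plane}
    (hg : InjOn g Ω) : InjOn (chartMap α hα g) (chartDomain α hα Ω) := by
  intro z hz w hw h
  have h1 := congrArg Complex.re h
  have h2 := congrArg Complex.im h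
  simp only [chartMap] at h1 h2
  have h3 := hg hz hw (Prod.ext ((strictMono_powChart hα).injective h1) h2)
  rw [Prod.mk.injEq] at h3
  exact Complex.ext ((powHomeo α hα).symm.injective h3.1) h3.2

/-- The complex derivative of `g` in the chart. -/
noncomputable def chartDeriv (α : ℝ) (hα : 0 < α) (g : Plane → Plane) (p : Plane) : ℂ :=
  deriv (chartMap α hα g) (chartPoint α p)

/-- A homeomorphism of a domain in the Grushin plane which is holomorphic in the chart. -/
structure IsChartHolomorphic (α : ℝ) (hα : 0 < α) (Ω : Set Plane) (g : Plane → Plane) :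
    Prop where
  isOpen : IsOpen Ω
  continuousOn : ContinuousOn g Ω
  injOn : InjOn g Ω
  differentiableOn : DifferentiableOn ℂ (chartMap α hα g) (chartDomain α hα Ω)

section

variable {α : ℝ} {hα : 0 < α} {Ω : Set Plane} {g : Plane → Plane}

lemma IsChartHolomorphic.chartDeriv_ne_zero (h : IsChartHolomorphic α hα Ω g) {p : Plane}
    (hp : p ∈ Ω) : chartDeriv α hα g p ≠ 0 :=
  deriv_ne_zero_of_injOn (isOpen_chartDomain hα h.isOpen) h.differentiableOn
    (injOn_chartMap hα h.injOn) (chartPoint_mem.2 hp)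

lemma IsChartHolomorphic.continuousOn_chartDeriv (h : IsChartHolomorphic α hα Ω g) :
    ContinuousOn (chartDeriv α hα g) Ω :=
  (h.differentiableOn.deriv (isOpen_chartDomain hα h.isOpen)).continuousOn.comp
    (continuous_chartPoint hα).continuousOn fun _ hp => chartPoint_mem.2 hp

/-- The chain rule along a curve, in the chart. -/
lemma IsChartHolomorphic.hasDerivAt_comp (h : IsChartHolomorphic α hα Ω g) {γ : ℝ → Plane}
    {t : ℝ} {v : Plane} (hγ : HasDerivAt γ v t) (ht : γ t ∈ Ω) :
    HasDerivAt (fun s => powChart α (g (γ s)).1)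
      (|(γ t).1| ^ α * (chartDeriv α hα g (γ t)).re * v.1 -
        (chartDeriv α hα g (γ t)).im * v.2) t ∧
    HasDerivAt (fun s => (g (γ s)).2)
      (|(γ t).1| ^ α * (chartDeriv α hα g (γ t)).im * v.1 +
        (chartDeriv α hα g (γ t)).re * v.2) t := by
  have hd : HasDerivAt (chartMap α hα g) (chartDeriv α hα g (γ t)) (chartPoint α (γ t)) :=
    (h.differentiableOn.differentiableAt
      ((isOpen_chartDomain hα h.isOpen).mem_nhds (chartPoint_mem.2 ht))).hasDerivAt
  have h1 : HasDerivAt (fun s => (γ s).1) v.1 t :=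
    (hasFDerivAt_fst (𝕜 := ℝ) (E := ℝ) (F := ℝ) (p := γ t)).comp_hasDerivAt t hγ
  have h2 : HasDerivAt (fun s => (γ s).2) v.2 t :=
    (hasFDerivAt_snd (𝕜 := ℝ) (E := ℝ) (F := ℝ) (p := γ t)).comp_hasDerivAt t hγ
  have h3 := (hasDerivAt_powChart hα (γ t).1).comp t h1
  have hZ : HasDerivAt (fun s => chartPoint α (γ s)) (⟨|(γ t).1| ^ α * v.1, v.2⟩ : ℂ) t :=
    Complex.equivRealProdCLM.symm.hasFDerivAt.comp_hasDerivAt t (h3.prodMk h2)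
  have hc : HasDerivAt (fun s => chartPoint α (g (γ s)))
      (chartDeriv α hα g (γ t) * ⟨|(γ t).1| ^ α * v.1, v.2⟩) t := by
    have := hd.comp_of_eq t hZ rfl
    refine this.congr_of_eventuallyEq (Eventually.of_forall fun s => ?_)
    simp only [Function.comp_apply, chartMap_chartPoint]
  constructor
  · have e : |(γ t).1| ^ α * (chartDeriv α hα g (γ t)).re * v.1 -
        (chartDeriv α hα g (γ t)).im * v.2 =
        (chartDeriv α hα g (γ t) * ⟨|(γ t).1| ^ α * v.1, v.2⟩).re := by
      rw [Complex.mul_re]; ring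
    rw [e]
    exact Complex.reCLM.hasFDerivAt.comp_hasDerivAt t hc
  · have e : |(γ t).1| ^ α * (chartDeriv α hα g (γ t)).im * v.1 +
        (chartDeriv α hα g (γ t)).re * v.2 =
        (chartDeriv α hα g (γ t) * ⟨|(γ t).1| ^ α * v.1, v.2⟩).im := by
      rw [Complex.mul_im]; ring
    rw [e]
    exact Complex.imCLM.hasFDerivAt.comp_hasDerivAt t hc

/-- The chain rule along a curve for the first component of the map. -/
lemma IsChartHolomorphic.hasDerivAt_comp_fst (h : IsChartHolomorphic α hα Ω g) {γ : ℝ → Plane}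
    {t : ℝ} {v : Plane} (hγ : HasDerivAt γ v t) (ht : γ t ∈ Ω) (h0 : (g (γ t)).1 ≠ 0) :
    HasDerivAt (fun s => (g (γ s)).1)
      ((|(g (γ t)).1| ^ α)⁻¹ * (|(γ t).1| ^ α * (chartDeriv α hα g (γ t)).re * v.1 -
        (chartDeriv α hα g (γ t)).im * v.2)) t := by
  have h1 := (hasDerivAt_powHomeo_symm hα h0).comp t (h.hasDerivAt_comp hγ ht).1
  refine h1.congr_of_eventuallyEq (Eventually.of_forall fun s => ?_)
  simp only [Function.comp_apply, symm_powChart]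

lemma hasDerivAt_mk_left (p : Plane) :
    HasDerivAt (fun s : ℝ => ((s, p.2) : Plane)) ((1, 0) : Plane) p.1 :=
  (hasDerivAt_id p.1).prodMk (hasDerivAt_const p.1 p.2)

lemma hasDerivAt_mk_right (p : Plane) :
    HasDerivAt (fun s : ℝ => ((p.1, s) : Plane)) ((0, 1) : Plane) p.2 :=
  (hasDerivAt_const p.2 p.1).prodMk (hasDerivAt_id p.2)

lemma IsChartHolomorphic.partialsExistAt (h : IsChartHolomorphic α hα Ω g) {p : Plane}
    (hp : p ∈ Ω) (h0 : (g p).1 ≠ 0) :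
    PartialsExistAt (fun q => (g q).1) p ∧ PartialsExistAt (fun q => (g q).2) p :=
  ⟨⟨(h.hasDerivAt_comp_fst (hasDerivAt_mk_left p) hp h0).differentiableAt,
    (h.hasDerivAt_comp_fst (hasDerivAt_mk_right p) hp h0).differentiableAt⟩,
    ⟨(h.hasDerivAt_comp (hasDerivAt_mk_left p) hp).2.differentiableAt,
    (h.hasDerivAt_comp (hasDerivAt_mk_right p) hp).2.differentiableAt⟩⟩

/-- Here `D_α g` is `|x|^α / |g₁|^α` times the real matrix of multiplication by `F'`, in which `Re
F'` and `Im F'` each occur twice. With the denominator cleared, the identity can be passed to the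
limit at singular points. -/
lemma IsChartHolomorphic.sum_sq_matrixD (h : IsChartHolomorphic α hα Ω g) {p : Plane}
    (hp : p ∈ Ω) (h0 : (g p).1 ≠ 0) :
    (|(g p).1| ^ α) ^ 2 * ∑ i, ∑ j, matrixD α g p i j ^ 2 =
      2 * (|p.1| ^ α) ^ 2 * Complex.normSq (chartDeriv α hα g p) := by
  have hw : 0 < |(g p).1| ^ α := Real.rpow_pos_of_pos (abs_pos.2 h0) α
  have d1 := (h.hasDerivAt_comp_fst (hasDerivAt_mk_left p) hp h0).deriv
  have d2 := (h.hasDerivAt_comp_fst (hasDerivAt_mk_right p) hp h0).deriv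
  have d3 := (h.hasDerivAt_comp (hasDerivAt_mk_left p) hp).2.deriv
  have d4 := (h.hasDerivAt_comp (hasDerivAt_mk_right p) hp).2.deriv
  simp only [Fin.sum_univ_two, matrixD, fieldX, fieldY, partialX, partialY, Matrix.of_apply,
    Matrix.cons_val_zero, Matrix.cons_val_one, Matrix.cons_val', Matrix.cons_val_fin_one,
    d1, d2, d3, d4, Complex.normSq_apply]
  field_simp
  ring

lemma IsChartHolomorphic.exists_pos_eq (h : IsChartHolomorphic α hα Ω g)
    (hne : ∀ᵐ p, p ∈ Ω → (g p).1 ≠ 0) {p₀ : Plane} (hp₀ : p₀ ∈ Ω)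
    {L : Matrix (Fin 2) (Fin 2) ℝ} (hL : L ≠ 0)
    (hlim : Tendsto (matrixD α g)
      (𝓝[{p | p ∈ regularSet Ω g ∧ PartialsExistAt (fun q => (g q).1) p ∧
        PartialsExistAt (fun q => (g q).2) p}] p₀) (𝓝 L)) :
    ∃ S > 0, (|(g p₀).1| ^ α) ^ 2 * S =
      2 * (|p₀.1| ^ α) ^ 2 * Complex.normSq (chartDeriv α hα g p₀) := by
  set T := {p | p ∈ regularSet Ω g ∧ PartialsExistAt (fun q => (g q).1) p ∧
        PartialsExistAt (fun q => (g q).2) p} with hT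
  refine ⟨∑ i, ∑ j, L i j ^ 2, ?_, ?_⟩
  · obtain ⟨i, j, hij⟩ : ∃ i j, L i j ≠ 0 := by
      by_contra! h'
      exact hL (Matrix.ext h')
    refine Finset.sum_pos' (fun i _ => Finset.sum_nonneg fun j _ => sq_nonneg _)
      ⟨i, Finset.mem_univ i, ?_⟩
    exact Finset.sum_pos' (fun j _ => sq_nonneg _) ⟨j, Finset.mem_univ j, by positivity⟩
  -- The limit is informative only if `T` accumulates at `p₀`. It does, because almost every point
  -- of `Ω` is regular with all partial derivatives, and open sets have positive measure.
  have hne' : NeBot (𝓝[T] p₀) := by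
    rw [← mem_closure_iff_nhdsWithin_neBot, mem_closure_iff_nhds]
    intro V hV
    by_contra hempty
    have hpos := Measure.measure_pos_of_mem_nhds volume (inter_mem hV (h.isOpen.mem_nhds hp₀))
    refine hpos.ne' (measure_mono_null (t := {p | ¬((p ∈ Ω → (g p).1 ≠ 0) ∧ p.1 ≠ 0)})
      (fun p hp hp2 => hempty ⟨p, hp.1, ?_⟩) (ae_iff.1 (hne.and ae_fst_coord_ne_zero)))
    have hg0 := hp2.1 hp.2
    exact ⟨⟨hp.2, fun hs => hs.2.elim hp2.2 hg0⟩, h.partialsExistAt hp.2 hg0⟩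
  have hTΩ : T ⊆ Ω := fun p hp => hp.1.1
  have t1 : Tendsto (fun p => (|(g p).1| ^ α) ^ 2 * ∑ i, ∑ j, matrixD α g p i j ^ 2) (𝓝[T] p₀)
      (𝓝 ((|(g p₀).1| ^ α) ^ 2 * ∑ i, ∑ j, L i j ^ 2)) := by
    refine Tendsto.mul ?_ ?_
    · have : ContinuousWithinAt (fun p => (|(g p).1| ^ α) ^ 2) Ω p₀ :=
        (((continuous_abs_rpow hα).pow 2).comp_continuousOn
          (continuous_fst.comp_continuousOn h.continuousOn)) p₀ hp₀
      exact this.mono hTΩ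
    · have hc : Continuous fun M : Matrix (Fin 2) (Fin 2) ℝ => ∑ i, ∑ j, M i j ^ 2 := by
        refine continuous_finsetSum _ fun i _ => continuous_finsetSum _ fun j _ => ?_
        exact (continuous_id.matrix_elem i j).pow 2
      exact (hc.tendsto L).comp hlim
  have t2 : Tendsto (fun p => 2 * (|p.1| ^ α) ^ 2 * Complex.normSq (chartDeriv α hα g p))
      (𝓝[T] p₀) (𝓝 (2 * (|p₀.1| ^ α) ^ 2 * Complex.normSq (chartDeriv α hα g p₀))) := by
    have : ContinuousOn (fun p => 2 * (|p.1| ^ α) ^ 2 *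
        Complex.normSq (chartDeriv α hα g p)) Ω :=
      (continuous_const.mul (((continuous_abs_rpow hα).pow 2).comp continuous_fst)).continuousOn.mul
        (Complex.continuous_normSq.comp_continuousOn h.continuousOn_chartDeriv)
    exact (this p₀ hp₀).mono hTΩ
  refine tendsto_nhds_unique (t1.congr' ?_) t2
  filter_upwards [self_mem_nhdsWithin] with p hp
  exact h.sum_sq_matrixD hp.1.1 fun h0 => hp.1.2 ⟨hp.1.1, Or.inr h0⟩

end

lemma IsConformal.isChartHolomorphic {α : ℝ} (hα : 0 < α) {Ω Ω' : Set Plane} (hΩ : IsOpen Ω)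
    {g : Plane → Plane} (h : IsConformal α Ω Ω' g) (hor : IsOrientationPreserving α Ω Ω' g) :
    IsChartHolomorphic α hα Ω g := by
  obtain ⟨-, hg, k, -, -, hk⟩ := h.homeo
  exact ⟨hΩ, hg, hk.1.injOn,
    (h.isWeaklyConformal hΩ hor).differentiableOn_chartMap hα hΩ hg⟩

/-- A conformal map preserves the singular line and its complement. -/
lemma IsConformal.fst_eq_zero_iff {α : ℝ} (hα : 0 < α) {Ω Ω' : Set Plane} (hΩ : IsOpen Ω)
    {g : Plane → Plane} (h : IsConformal α Ω Ω' g) (hor : IsOrientationPreserving α Ω Ω' g)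
    {p : Plane} (hp : p ∈ Ω) : (g p).1 = 0 ↔ p.1 = 0 := by
  have hh := h.isChartHolomorphic hα hΩ hor
  have hne := ae_fst_ne_zero hΩ h.homeo.2.1 hor.2
  have hA := Complex.normSq_pos.2 (hh.chartDeriv_ne_zero hp)
  -- In the limiting identity `S` and `|F'|²` are both positive, so one weight vanishes exactly when
  -- the other does.
  have key : (p.1 = 0 ∨ (g p).1 = 0) → ((g p).1 = 0 ↔ p.1 = 0) := fun hs => by
    obtain ⟨L, hL, hlim⟩ := h.limit_singular p ⟨hp, hs⟩
    obtain ⟨S, hS, heq⟩ := hh.exists_pos_eq hne hp hL hlim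
    have e : ∀ x : ℝ, |x| ^ α = 0 ↔ x = 0 := fun x => by
      rw [Real.rpow_eq_zero (abs_nonneg x) hα.ne', abs_eq_zero]
    rw [← e, ← e p.1]
    constructor
    · intro h0
      rw [h0] at heq
      by_contra h1
      have : 0 < 2 * (|p.1| ^ α) ^ 2 * Complex.normSq (chartDeriv α hα g p) := by positivity
      rw [← heq] at this
      simp at this
    · intro h0
      rw [h0] at heq
      by_contra h1
      have : 0 < (|(g p).1| ^ α) ^ 2 * S := by positivity
      rw [heq] at this
      simp at this
  constructor
  · exact fun h0 => (key (Or.inr h0)).1 h0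
  · exact fun h0 => (key (Or.inl h0)).2 h0

/-! ### Local estimates near and away from the singular line -/

lemma powChart_zero (α : ℝ) : powChart α 0 = 0 := by simp [powChart]

lemma chartPoint_re (α : ℝ) (p : Plane) : (chartPoint α p).re = powChart α p.1 := rfl

/-- Quantitative comparison, at a point, of the map `g` and its chart derivative with the
degeneration of the Grushin plane. -/
structure ChartBound (α : ℝ) (hα : 0 < α) (g : Plane → Plane) (C : ℝ) (p : Plane) : Prop where
  le_fst : |p.1| ^ α ≤ C * |(g p).1| ^ α
  fst_le : |(g p).1| ^ α ≤ C * |p.1| ^ α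
  im_le_mul : |(chartDeriv α hα g p).im| ≤ C * |p.1| ^ α
  re_le : |(chartDeriv α hα g p).re| ≤ C
  im_le : |(chartDeriv α hα g p).im| ≤ C
  rpow_le : |p.1| ^ α ≤ C
  one_le : 1 ≤ C * (|p.1| ^ α + |(chartDeriv α hα g p).re|)

lemma ChartBound.mono {α : ℝ} {hα : 0 < α} {g : Plane → Plane} {C C' : ℝ} {p : Plane}
    (h : ChartBound α hα g C p) (hC : C ≤ C') : ChartBound α hα g C' p := by
  obtain ⟨h1, h2, h3, h4, h5, h6, h7⟩ := h
  refine ⟨h1.trans ?_, h2.trans ?_, h3.trans ?_, h4.trans hC, h5.trans hC, h6.trans hC,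
    h7.trans ?_⟩ <;>
    gcongr

/-- A family of properties which is monotone in a constant and holds locally holds uniformly on
compact sets. -/
lemma exists_forall_of_isCompact {K : Set Plane} (hK : IsCompact K) {Q : ℝ → Plane → Prop}
    (hmono : ∀ C C' p, C ≤ C' → Q C p → Q C' p)
    (hloc : ∀ p ∈ K, ∃ C, ∀ᶠ q in 𝓝 p, Q C q) : ∃ C, ∀ p ∈ K, Q C p := by
  refine hK.induction_on (p := fun s => ∃ C, ∀ p ∈ s, Q C p) ⟨0, fun p hp => hp.elim⟩
    (fun s t hst ⟨C, hC⟩ => ⟨C, fun p hp => hC p (hst hp)⟩)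
    (fun s t ⟨C, hC⟩ ⟨C', hC'⟩ => ⟨max C C', fun p hp => hp.elim
      (fun h => hmono _ _ _ (le_max_left _ _) (hC p h))
      fun h => hmono _ _ _ (le_max_right _ _) (hC' p h)⟩) fun p hp => ?_
  obtain ⟨C, hC⟩ := hloc p hp
  exact ⟨_, mem_nhdsWithin_of_mem_nhds hC, C, fun q hq => hq⟩

lemma exists_eventually_le_mul {F K : Plane → ℝ} {p : Plane} (hF : ContinuousAt F p)
    (hK : ContinuousAt K p) (h0 : 0 < K p) : ∃ C, 0 ≤ C ∧ ∀ᶠ q in 𝓝 p, F q ≤ C * K q := by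
  refine ⟨(|F p| + 1) / (K p / 2), by positivity, ?_⟩
  filter_upwards [hF.eventually_lt_const (show F p < |F p| + 1 by linarith [le_abs_self (F p)]),
    hK.eventually_const_lt (show K p / 2 < K p by linarith)] with q h1 h2
  rw [div_mul_eq_mul_div, le_div_iff₀ (by positivity)]
  nlinarith [abs_nonneg (F p)]

lemma rpow_le_mul_rpow_of_rpow_add_one_le {α x y K : ℝ} (hα : 0 < α) (hx : 0 ≤ x) (hy : 0 ≤ y)
    (hK : 0 ≤ K) (h : x ^ (α + 1) ≤ K * y ^ (α + 1)) :
    x ^ α ≤ K ^ (α / (α + 1)) * y ^ α := by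
  have e : ∀ t : ℝ, 0 ≤ t → (t ^ (α + 1)) ^ (α / (α + 1)) = t ^ α := fun t ht => by
    rw [← Real.rpow_mul ht]
    congr 1
    field_simp
  have h2 := Real.rpow_le_rpow (by positivity) h (show 0 ≤ α / (α + 1) by positivity)
  rwa [Real.mul_rpow hK (by positivity), e x hx, e y hy] at h2

section

variable {α : ℝ} {hα : 0 < α} {Ω : Set Plane} {g : Plane → Plane}

/-- On the singular line `Re F` is identically zero, and its `y`-derivative is `-Im F'`. -/
lemma IsChartHolomorphic.chartDeriv_im_eq_zero (h : IsChartHolomorphic α hα Ω g)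
    (hz : ∀ p ∈ Ω, p.1 = 0 → (g p).1 = 0) {p : Plane} (hp : p ∈ Ω) (h0 : p.1 = 0) :
    (chartDeriv α hα g p).im = 0 := by
  have h1 := (h.hasDerivAt_comp (hasDerivAt_mk_right p) hp).1
  have h2 : HasDerivAt (fun s => powChart α (g (p.1, s)).1) 0 p.2 := by
    refine (hasDerivAt_const p.2 (0 : ℝ)).congr_of_eventuallyEq ?_
    have : ∀ᶠ s in 𝓝 p.2, ((p.1, s) : Plane) ∈ Ω :=
      (hasDerivAt_mk_right p).continuousAt.preimage_mem_nhds (h.isOpen.mem_nhds hp)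
    filter_upwards [this] with s hs
    rw [powChart_eq_zero hα]
    exact hz _ hs h0
  have := h1.unique h2
  simpa using this

/-- Near the singular line the chart coordinate of the image is comparable to that of the
point, and the imaginary part of the derivative is small. -/
lemma IsChartHolomorphic.exists_singular_bound (h : IsChartHolomorphic α hα Ω g)
    (hz : ∀ p ∈ Ω, p.1 = 0 → (g p).1 = 0) {p₀ : Plane} (hp₀ : p₀ ∈ Ω) (h0 : p₀.1 = 0) :
    ∃ C, 0 ≤ C ∧ ∀ᶠ p in 𝓝 p₀, |p.1| ^ (α + 1) ≤ C * |(g p).1| ^ (α + 1) ∧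
      |(g p).1| ^ (α + 1) ≤ C * |p.1| ^ (α + 1) ∧
      |(chartDeriv α hα g p).im| ≤ C * |p.1| ^ (α + 1) := by
  have hUn := (isOpen_chartDomain hα h.isOpen).mem_nhds (chartPoint_mem.2 hp₀)
  have han : AnalyticAt ℂ (chartMap α hα g) (chartPoint α p₀) := h.differentiableOn.analyticAt hUn
  have hA : chartDeriv α hα g p₀ ≠ 0 := h.chartDeriv_ne_zero hp₀
  have him := h.chartDeriv_im_eq_zero hz hp₀ h0
  set c := |(chartDeriv α hα g p₀).re| with hc
  have hcpos : 0 < c := abs_pos.2 fun hre => hA (Complex.ext hre him)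
  have hα1 : 0 < α + 1 := by linarith
  -- Each `p` is compared with its projection `(0, y)` to the singular line; their chart points
  -- differ by the real number `powChart α x`.
  have hpair : Tendsto (fun p : Plane => (chartPoint α p, chartPoint α (0, p.2))) (𝓝 p₀)
      (𝓝 (chartPoint α p₀, chartPoint α p₀)) := by
    have hcont : Continuous fun p : Plane => (chartPoint α p, chartPoint α (0, p.2)) :=
      (continuous_chartPoint hα).prodMk
        ((continuous_chartPoint hα).comp (continuous_const.prodMk continuous_snd))
    have e : ((0, p₀.2) : Plane) = p₀ := Prod.ext h0.symm rfl
    simpa only [e] using hcont.tendsto p₀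
  -- Strict differentiability compares two points that both move, with error at most half of `|F'
  -- p₀| = c`.
  have e1 := hpair.eventually (han.hasStrictDerivAt.isLittleO.def (half_pos hcpos))
  -- `F'` is itself analytic, hence Lipschitz near the point; `Im F'` vanishes at the projection, so
  -- it is `O(|u|)` at `p`.
  obtain ⟨M, hM, hbig⟩ := han.deriv.hasStrictDerivAt.hasStrictFDerivAt.isBigO_sub.exists_pos
  have e2 := hpair.eventually hbig.bound
  have e3 : ∀ᶠ p : Plane in 𝓝 p₀, ((0, p.2) : Plane) ∈ Ω := by
    have hcont : Continuous fun p : Plane => ((0, p.2) : Plane) := by fun_prop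
    refine hcont.continuousAt.preimage_mem_nhds (h.isOpen.mem_nhds ?_)
    rwa [← h0]
  have hsub : ∀ p : Plane, chartPoint α p - chartPoint α (0, p.2) = (powChart α p.1 : ℂ) :=
    fun p => Complex.ext (by simp [chartPoint, powChart_zero]) (by simp [chartPoint])
  -- The estimates below give `(c / 2) X ≤ Y ≤ (3 c / 2) X` and a bound `M / (α + 1)` for the
  -- imaginary part; the sum serves all three.
  refine ⟨2 / c + 3 * c / 2 + M / (α + 1), by positivity, ?_⟩
  filter_upwards [e1, e2, e3] with p h1 h2 h3
  rw [hsub, Complex.norm_real, Real.norm_eq_abs, abs_powChart hα] at h1 h2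
  have g0 : (g (0, p.2)).1 = 0 := hz _ h3 rfl
  have b1 : |powChart α (g p).1 - powChart α p.1 * (chartDeriv α hα g p₀).re| ≤
      c / 2 * (|p.1| ^ (α + 1) / (α + 1)) := by
    refine le_trans ?_ (le_trans (Complex.abs_re_le_norm _) h1)
    refine le_of_eq (congrArg _ ?_)
    simp only [chartMap_chartPoint, ContinuousLinearMap.toSpanSingleton_apply, smul_eq_mul,
      Complex.sub_re, Complex.re_ofReal_mul, chartPoint_re, g0, powChart_zero, sub_zero, chartDeriv]
  have b2 : |powChart α p.1 * (chartDeriv α hα g p₀).re| = |p.1| ^ (α + 1) / (α + 1) * c := by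
    rw [abs_mul, abs_powChart hα]
  have b3 : |(chartDeriv α hα g p).im| ≤ M * (|p.1| ^ (α + 1) / (α + 1)) := by
    refine le_trans ?_ (le_trans (Complex.abs_im_le_norm _) h2)
    refine le_of_eq (congrArg _ ?_)
    have := h.chartDeriv_im_eq_zero hz h3 rfl
    rw [chartDeriv] at this
    rw [Complex.sub_im, this, sub_zero, chartDeriv]
  set X := |p.1| ^ (α + 1) with hX
  set Y := |(g p).1| ^ (α + 1) with hY
  have hX0 : 0 ≤ X := by positivity
  have hY0 : 0 ≤ Y := by positivity
  have b4 : |powChart α (g p).1| = Y / (α + 1) := abs_powChart hα _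
  have b5 := abs_sub_abs_le_abs_sub (powChart α (g p).1)
    (powChart α p.1 * (chartDeriv α hα g p₀).re)
  have b6 := abs_sub_abs_le_abs_sub (powChart α p.1 * (chartDeriv α hα g p₀).re)
    (powChart α (g p).1)
  rw [abs_sub_comm] at b6
  rw [b2, b4] at b5 b6
  have b7 : Y ≤ 3 * c / 2 * X := by
    have : Y / (α + 1) ≤ (3 * c / 2 * X) / (α + 1) := by
      have : (3 * c / 2 * X) / (α + 1) = c / 2 * (X / (α + 1)) + X / (α + 1) * c := by ring
      linarith
    exact (div_le_div_iff_of_pos_right hα1).1 this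
  have b8 : c / 2 * X ≤ Y := by
    have : (c / 2 * X) / (α + 1) ≤ Y / (α + 1) := by
      have : (c / 2 * X) / (α + 1) = X / (α + 1) * c - c / 2 * (X / (α + 1)) := by ring
      linarith
    exact (div_le_div_iff_of_pos_right hα1).1 this
  have p1 : 0 ≤ 2 / c := by positivity
  have p2 : 0 ≤ 3 * c / 2 := by positivity
  have p3 : 0 ≤ M / (α + 1) := by positivity
  refine ⟨?_, ?_, ?_⟩
  · have : X ≤ 2 / c * Y := by
      rw [div_mul_eq_mul_div, le_div_iff₀ hcpos]
      linarith
    nlinarith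
  · nlinarith
  · have : M * (X / (α + 1)) = M / (α + 1) * X := by ring
    nlinarith

/-- Local comparison estimates for a map which is holomorphic in the chart and preserves the
singular line. -/
lemma IsChartHolomorphic.exists_chartBound (h : IsChartHolomorphic α hα Ω g)
    (hz : ∀ p ∈ Ω, (g p).1 = 0 ↔ p.1 = 0) {p₀ : Plane} (hp₀ : p₀ ∈ Ω) :
    ∃ C, ∀ᶠ p in 𝓝 p₀, ChartBound α hα g C p := by
  have hz' : ∀ p ∈ Ω, p.1 = 0 → (g p).1 = 0 := fun p hp => (hz p hp).2
  have hn := h.isOpen.mem_nhds hp₀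
  have hA := h.continuousOn_chartDeriv.continuousAt hn
  have hre : ContinuousAt (fun p => |(chartDeriv α hα g p).re|) p₀ :=
    (Complex.continuous_re.continuousAt.comp hA).abs
  have him : ContinuousAt (fun p => |(chartDeriv α hα g p).im|) p₀ :=
    (Complex.continuous_im.continuousAt.comp hA).abs
  have hx : ContinuousAt (fun p : Plane => |p.1| ^ α) p₀ :=
    ((continuous_abs_rpow hα).comp continuous_fst).continuousAt
  have hg : ContinuousAt (fun p : Plane => |(g p).1| ^ α) p₀ :=
    (continuous_abs_rpow hα).continuousAt.comp
      (continuous_fst.continuousAt.comp (h.continuousOn.continuousAt hn))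
  have hpos : ∀ x : ℝ, x ≠ 0 → 0 < |x| ^ α := fun x hx => by positivity
  have key : ∃ C, 0 ≤ C ∧ ∀ᶠ p in 𝓝 p₀, |p.1| ^ α ≤ C * |(g p).1| ^ α ∧
      |(g p).1| ^ α ≤ C * |p.1| ^ α ∧ |(chartDeriv α hα g p).im| ≤ C * |p.1| ^ α := by
    by_cases h0 : p₀.1 = 0
    · obtain ⟨C, hC, hev⟩ := h.exists_singular_bound hz' hp₀ h0
      have hsmall : ∀ᶠ p : Plane in 𝓝 p₀, |p.1| < 1 := by
        have : ContinuousAt (fun p : Plane => |p.1|) p₀ := by fun_prop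
        exact this.eventually_lt_const (by simp [h0])
      have hC' : 0 ≤ C ^ (α / (α + 1)) := by positivity
      -- Lowering the exponent from `α + 1` to `α` replaces `C` by `C ^ (α / (α + 1))`. The
      -- imaginary part keeps `C`, since `|x|^(α + 1) ≤ |x|^α` for `|x| < 1`.
      refine ⟨C + C ^ (α / (α + 1)), by positivity, ?_⟩
      filter_upwards [hev, hsmall] with p ⟨h1, h2, h3⟩ h4
      have i1 := rpow_le_mul_rpow_of_rpow_add_one_le hα (abs_nonneg _) (abs_nonneg _) hC h1
      have i2 := rpow_le_mul_rpow_of_rpow_add_one_le hα (abs_nonneg _) (abs_nonneg _) hC h2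
      have n1 : 0 ≤ |p.1| ^ α := by positivity
      have n2 : 0 ≤ |(g p).1| ^ α := by positivity
      refine ⟨by nlinarith, by nlinarith, h3.trans ?_⟩
      rw [Real.rpow_add_one' (abs_nonneg _) (by linarith)]
      have : |p.1| ^ α * |p.1| ≤ |p.1| ^ α := mul_le_of_le_one_right n1 h4.le
      nlinarith [mul_le_mul_of_nonneg_left this hC, mul_nonneg hC' n1]
    · have h0' : (g p₀).1 ≠ 0 := fun h' => h0 ((hz p₀ hp₀).1 h')
      obtain ⟨C1, c1, e1⟩ := exists_eventually_le_mul hx hg (hpos _ h0')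
      obtain ⟨C2, c2, e2⟩ := exists_eventually_le_mul hg hx (hpos _ h0)
      obtain ⟨C3, c3, e3⟩ := exists_eventually_le_mul him hx (hpos _ h0)
      refine ⟨C1 + C2 + C3, by positivity, ?_⟩
      filter_upwards [e1, e2, e3] with p h1 h2 h3
      refine ⟨h1.trans ?_, h2.trans ?_, h3.trans ?_⟩ <;> gcongr <;> linarith
  obtain ⟨C1, c1, e1⟩ := key
  obtain ⟨C2, c2, e2⟩ := exists_eventually_le_mul hre
    (continuousAt_const (y := (1 : ℝ))) one_pos
  obtain ⟨C3, c3, e3⟩ := exists_eventually_le_mul him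
    (continuousAt_const (y := (1 : ℝ))) one_pos
  obtain ⟨C5, c5, e5⟩ := exists_eventually_le_mul hx
    (continuousAt_const (y := (1 : ℝ))) one_pos
  -- On the singular line `F' ≠ 0` is real, so `Re F' ≠ 0`; off the line `|x|^α > 0`.
  have hpos6 : 0 < |p₀.1| ^ α + |(chartDeriv α hα g p₀).re| := by
    by_cases h0 : p₀.1 = 0
    · have hA0 := h.chartDeriv_ne_zero hp₀
      have := h.chartDeriv_im_eq_zero hz' hp₀ h0
      have hre0 : 0 < |(chartDeriv α hα g p₀).re| :=
        abs_pos.2 fun hre => hA0 (Complex.ext hre this)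
      positivity
    · have := hpos _ h0
      positivity
  obtain ⟨C4, c4, e4⟩ := exists_eventually_le_mul
    (continuousAt_const (y := (1 : ℝ))) (hx.add hre) hpos6
  refine ⟨C1 + C2 + C3 + C4 + C5, ?_⟩
  filter_upwards [e1, e2, e3, e4, e5] with p ⟨h1, h1', h1''⟩ h2 h3 h4 h5
  simp only [mul_one, Pi.add_apply] at h2 h3 h4 h5
  refine ⟨h1.trans ?_, h1'.trans ?_, h1''.trans ?_, h2.trans (by linarith),
    h3.trans (by linarith), h5.trans (by linarith), h4.trans ?_⟩ <;> gcongr <;> linarith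

end

/-! ### Local Lipschitz continuity -/

/-- The mean value inequality on `[0, 1]` with a countable exceptional set. -/
lemma abs_sub_le_of_abs_deriv_le_off_countable {k : ℝ → ℝ} {C : ℝ} {s : Set ℝ}
    (hs : s.Countable) (hk : ContinuousOn k (Icc 0 1))
    (hd : ∀ x ∈ Ioo (0 : ℝ) 1, x ∉ s → ∃ k', HasDerivAt k k' x ∧ |k'| ≤ C) :
    |k 1 - k 0| ≤ C := by
  have hb : ∀ᵐ x : ℝ, x ∈ Ioc (0 : ℝ) 1 → ‖deriv k x‖ ≤ C := by
    have h1 : ∀ᵐ x : ℝ, x ≠ 1 := by simp [ae_iff]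
    filter_upwards [hs.ae_notMem volume, h1] with x hx hx1 hx2
    obtain ⟨k', hk', hC⟩ := hd x ⟨hx2.1, lt_of_le_of_ne hx2.2 hx1⟩ hx
    rwa [hk'.deriv, Real.norm_eq_abs]
  have hint : IntervalIntegrable (deriv k) volume 0 1 := by
    rw [intervalIntegrable_iff_integrableOn_Ioc_of_le zero_le_one]
    exact Measure.integrableOn_of_bounded (M := C) (by simp)
      (measurable_deriv k).aestronglyMeasurable
      ((ae_restrict_iff' measurableSet_Ioc).2 hb)
  have h := integral_eq_of_hasDerivAt_off_countable_of_le k (deriv k) zero_le_one hs hk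
    (fun x hx => by
      obtain ⟨k', hk', -⟩ := hd x hx.1 hx.2
      rwa [hk'.deriv]) hint
  rw [← h, ← Real.norm_eq_abs]
  have := intervalIntegral.norm_integral_le_of_norm_le_const_ae (a := (0 : ℝ)) (b := 1)
    (f := deriv k) (C := C) (by rwa [uIoc_of_le zero_le_one])
  simpa using this

section

variable {α : ℝ} {hα : 0 < α} {Ω : Set Plane} {g : Plane → Plane} {C : ℝ} {p : Plane}

lemma ChartBound.nonneg (h : ChartBound α hα g C p) : 0 ≤ C := (abs_nonneg _).trans h.re_le

/-- The singular factor `|g₁|^(-α)` is absorbed: one term carries `|x|^α ≤ C |g₁|^α`, the other `|Im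
F'| ≤ C |x|^α`. The expression is the velocity of `g₁` along a curve with velocity `(a, b)`. -/
lemma ChartBound.abs_fst_le (h : ChartBound α hα g C p) (h0 : (g p).1 ≠ 0) (a b : ℝ) :
    |(|(g p).1| ^ α)⁻¹ * (|p.1| ^ α * (chartDeriv α hα g p).re * a -
      (chartDeriv α hα g p).im * b)| ≤ C ^ 2 * (|a| + |b|) := by
  have hw : 0 < |(g p).1| ^ α := by positivity
  have hm : 0 ≤ |p.1| ^ α := by positivity
  have hC := h.nonneg
  rw [abs_mul, abs_inv, abs_of_pos hw, inv_mul_le_iff₀ hw]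
  calc _ ≤ |p.1| ^ α * (|(chartDeriv α hα g p).re| * |a|) +
        |(chartDeriv α hα g p).im| * |b| := by
        refine (abs_sub _ _).trans (le_of_eq ?_)
        rw [abs_mul, abs_mul, abs_mul, abs_of_nonneg hm, mul_assoc]
    _ ≤ (C * |(g p).1| ^ α) * (C * |a|) + (C * (C * |(g p).1| ^ α)) * |b| := by
        have h1 := h.le_fst
        have h2 := h.re_le
        have h3 := h.im_le_mul.trans (mul_le_mul_of_nonneg_left h1 hC)
        gcongr
    _ = _ := by ring

lemma ChartBound.abs_snd_le (h : ChartBound α hα g C p) (a b : ℝ) :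
    |(|p.1| ^ α * (chartDeriv α hα g p).im * a + (chartDeriv α hα g p).re * b)| ≤
      C ^ 2 * |a| + C * |b| := by
  have hm : 0 ≤ |p.1| ^ α := by positivity
  have hC := h.nonneg
  calc _ ≤ |p.1| ^ α * |(chartDeriv α hα g p).im| * |a| +
        |(chartDeriv α hα g p).re| * |b| := by
        refine (abs_add_le _ _).trans (le_of_eq ?_)
        rw [abs_mul, abs_mul, abs_mul, abs_of_nonneg hm]
    _ ≤ (C * C) * |a| + C * |b| := by
        have h1 := h.rpow_le
        have h2 := h.re_le
        have h3 := h.im_le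
        gcongr
    _ = _ := by ring

/-- Holomorphy alone does not suffice, since the inverse chart is not Lipschitz at the singular
line. The velocity bounds are integrated along segments in a ball. -/
lemma IsChartHolomorphic.locallyLipschitzOn (h : IsChartHolomorphic α hα Ω g)
    (hz : ∀ p ∈ Ω, (g p).1 = 0 ↔ p.1 = 0) : LocallyLipschitzOn Ω g := by
  intro p₀ hp₀
  obtain ⟨C, hC⟩ := h.exists_chartBound hz hp₀
  obtain ⟨r, hr, hball⟩ := Metric.mem_nhds_iff.1 (inter_mem (h.isOpen.mem_nhds hp₀) hC)
  have hC0 : 0 ≤ C := (hball (Metric.mem_ball_self hr)).2.nonneg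
  refine ⟨(2 * C ^ 2 + C).toNNReal, Metric.ball p₀ r,
    mem_nhdsWithin_of_mem_nhds (Metric.ball_mem_nhds p₀ hr), ?_⟩
  refine LipschitzOnWith.of_dist_le_mul fun q hq q' hq' => ?_
  rw [Real.coe_toNNReal _ (by positivity)]
  set γ : ℝ → Plane := fun s => q' + s • (q - q') with hγ
  have hγd : ∀ s, HasDerivAt γ (q - q') s := fun s => by
    simpa [hγ] using ((hasDerivAt_id s).smul_const (q - q')).const_add q'
  have hγB : ∀ s ∈ Icc (0 : ℝ) 1, γ s ∈ Ω ∧ ChartBound α hα g C (γ s) := fun s hs =>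
    hball ((convex_ball p₀ r).add_smul_sub_mem hq' hq hs)
  have hγc : ContinuousOn (fun s => g (γ s)) (Icc 0 1) :=
    h.continuousOn.comp (fun s _ => (hγd s).continuousAt.continuousWithinAt)
      fun s hs => (hγB s hs).1
  have hv1 : |(q - q').1| ≤ dist q q' := by
    rw [dist_eq_norm, ← Real.norm_eq_abs]; exact norm_fst_le (q - q')
  have hv2 : |(q - q').2| ≤ dist q q' := by
    rw [dist_eq_norm, ← Real.norm_eq_abs]; exact norm_snd_le (q - q')
  have hγ0 : γ 0 = q' := by simp [hγ]
  have hγ1 : γ 1 = q := by simp [hγ]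
  have hdist : 0 ≤ dist q q' := dist_nonneg
  have b2 : |(g q).2 - (g q').2| ≤ (2 * C ^ 2 + C) * dist q q' := by
    have := abs_sub_le_of_abs_deriv_le_off_countable (k := fun s => (g (γ s)).2)
      (C := (2 * C ^ 2 + C) * dist q q') countable_empty
      (continuous_snd.comp_continuousOn hγc) (fun s hs _ => by
        obtain ⟨hsΩ, hsB⟩ := hγB s (Ioo_subset_Icc_self hs)
        refine ⟨_, (h.hasDerivAt_comp (hγd s) hsΩ).2, (hsB.abs_snd_le _ _).trans ?_⟩
        nlinarith [mul_le_mul_of_nonneg_left hv1 (sq_nonneg C),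
          mul_le_mul_of_nonneg_left hv2 hC0, mul_nonneg (sq_nonneg C) hdist])
    simpa only [hγ0, hγ1] using this
  have b1 : |(g q).1 - (g q').1| ≤ (2 * C ^ 2 + C) * dist q q' := by
    -- A segment inside the singular line is mapped into it, so the difference of first components
    -- is zero. Any other segment meets the line at most once, and the mean value inequality
    -- tolerates that point.
    by_cases hcase : q'.1 = 0 ∧ (q - q').1 = 0
    · have hq1 : q.1 = 0 := by
        have := hcase.2
        rw [Prod.fst_sub, hcase.1, sub_zero] at this
        exact this
      rw [(hz q (hball hq).1).2 hq1, (hz q' (hball hq').1).2 hcase.1, sub_self, abs_zero]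
      positivity
    · have hcount : {s : ℝ | (γ s).1 = 0}.Countable := by
        refine Subsingleton.countable fun s hs t ht => ?_
        simp only [hγ, mem_ofPred_eq, Prod.fst_add, Prod.smul_fst, smul_eq_mul] at hs ht
        by_cases hv : (q - q').1 = 0
        · rw [hv, mul_zero, add_zero] at hs
          exact absurd ⟨hs, hv⟩ hcase
        · exact mul_right_cancel₀ hv (by linarith)
      have := abs_sub_le_of_abs_deriv_le_off_countable (k := fun s => (g (γ s)).1)
        (C := (2 * C ^ 2 + C) * dist q q') hcount
        (continuous_fst.comp_continuousOn hγc) (fun s hs hs0 => by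
          obtain ⟨hsΩ, hsB⟩ := hγB s (Ioo_subset_Icc_self hs)
          have hg0 : (g (γ s)).1 ≠ 0 := fun h' => hs0 ((hz _ hsΩ).1 h')
          refine ⟨_, h.hasDerivAt_comp_fst (hγd s) hsΩ hg0, (hsB.abs_fst_le hg0 _ _).trans ?_⟩
          nlinarith [mul_le_mul_of_nonneg_left (add_le_add hv1 hv2) (sq_nonneg C),
            mul_nonneg hC0 hdist])
      simpa only [hγ0, hγ1] using this
  rw [Prod.dist_eq, Real.dist_eq, Real.dist_eq]
  exact max_le b1 b2

/-! ### Transfer of admissibility -/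

lemma aestronglyMeasurable_deriv_div {a b : ℝ} {k w : ℝ → ℝ} (hw : ContinuousOn w (Icc a b)) :
    AEStronglyMeasurable (fun t => deriv k t / w t) (volume.restrict (Icc a b)) :=
  ((measurable_deriv k).aemeasurable.div
    (hw.aestronglyMeasurable measurableSet_Icc).aemeasurable).aestronglyMeasurable

variable {a b : ℝ} {γ : ℝ → Plane}

lemma IsChartHolomorphic.exists_chartBound_curve (h : IsChartHolomorphic α hα Ω g)
    (hz : ∀ p ∈ Ω, (g p).1 = 0 ↔ p.1 = 0) (hγ : ContinuousOn γ (Icc a b))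
    (hγΩ : MapsTo γ (Icc a b) Ω) : ∃ C, ∀ t ∈ Icc a b, ChartBound α hα g C (γ t) := by
  obtain ⟨C, hC⟩ := exists_forall_of_isCompact (isCompact_Icc.image_of_continuousOn hγ)
    (Q := ChartBound α hα g) (fun C C' p hCC' hp => hp.mono hCC') (by
      rintro _ ⟨t, ht, rfl⟩
      exact h.exists_chartBound hz (hγΩ ht))
  exact ⟨C, fun t ht => hC _ (mem_image_of_mem _ ht)⟩

lemma IsChartHolomorphic.absolutelyContinuous_comp (h : IsChartHolomorphic α hα Ω g)
    (hz : ∀ p ∈ Ω, (g p).1 = 0 ↔ p.1 = 0) (hab : a ≤ b)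
    (hγ : AbsolutelyContinuousOnInterval γ a b) (hγΩ : MapsTo γ (Icc a b) Ω) :
    AbsolutelyContinuousOnInterval (g ∘ γ) a b := by
  have hγc := hγ.continuousOn
  rw [uIcc_of_le hab] at hγc
  obtain ⟨K, hK⟩ := ((h.locallyLipschitzOn hz).mono
    (image_subset_iff.2 hγΩ)).exists_lipschitzOnWith_of_compact
    (isCompact_Icc.image_of_continuousOn hγc)
  refine absolutelyContinuousOnInterval_comp hK ?_ hγ
  rw [uIcc_of_le hab]
  exact mapsTo_image γ _

/-- Images of admissible curves are admissible. -/
lemma IsChartHolomorphic.isAdmissible_comp (h : IsChartHolomorphic α hα Ω g)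
    (hz : ∀ p ∈ Ω, (g p).1 = 0 ↔ p.1 = 0) (hab : a ≤ b) (hγΩ : MapsTo γ (Icc a b) Ω)
    (hγ0 : ∀ᵐ t ∂(volume.restrict (Icc a b)), (γ t).1 ≠ 0) (hadm : IsAdmissible α a b γ) :
    IsAdmissible α a b (g ∘ γ) := by
  obtain ⟨hac, u₁, u₂, hu₁, hu₂, hd⟩ := hadm
  have hγc := hac.continuousOn
  rw [uIcc_of_le hab] at hγc
  obtain ⟨C, hC⟩ := h.exists_chartBound_curve hz hγc hγΩ
  have hgc : ContinuousOn (fun t => |(g (γ t)).1| ^ α) (Icc a b) :=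
    (continuous_abs_rpow hα).comp_continuousOn
      (continuous_fst.comp_continuousOn (h.continuousOn.comp hγc hγΩ))
  have key : ∀ᵐ t ∂(volume.restrict (Icc a b)), ∃ w₁ w₂ : ℝ,
      HasDerivAt (fun s => (g (γ s)).1) w₁ t ∧ HasDerivAt (fun s => (g (γ s)).2) w₂ t ∧
      |(g (γ t)).1| ^ α ≠ 0 ∧ |w₁| ≤ C ^ 2 * |u₁ t| + C ^ 3 * |u₂ t| ∧
      |w₂ / |(g (γ t)).1| ^ α| ≤ C ^ 2 * |u₁ t| + C ^ 2 * |u₂ t| := by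
    filter_upwards [hd, hγ0, ae_restrict_mem measurableSet_Icc] with t ht ht0 htm
    have hB := hC t htm
    have hC0 := hB.nonneg
    have hg0 : (g (γ t)).1 ≠ 0 := fun h' => ht0 ((hz _ (hγΩ htm)).1 h')
    have hw : 0 < |(g (γ t)).1| ^ α := by positivity
    have hm : 0 ≤ |(γ t).1| ^ α := by positivity
    refine ⟨_, _, h.hasDerivAt_comp_fst ht (hγΩ htm) hg0, (h.hasDerivAt_comp ht (hγΩ htm)).2,
      hw.ne', (hB.abs_fst_le hg0 _ _).trans ?_, ?_⟩
    · simp only [Prod.fst_add, Prod.smul_fst, smul_eq_mul, mul_one, mul_zero, add_zero,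
        Prod.snd_add, Prod.smul_snd, zero_add, abs_mul, abs_of_nonneg hm]
      -- The coefficient `C ^ 3` comes from `y' = |x|^α u₂` and `|x|^α ≤ C`.
      have := mul_le_mul_of_nonneg_left hB.rpow_le (abs_nonneg (u₂ t))
      nlinarith [mul_le_mul_of_nonneg_left this (sq_nonneg C)]
    · simp only [Prod.fst_add, Prod.smul_fst, smul_eq_mul, mul_one, mul_zero, add_zero,
        Prod.snd_add, Prod.smul_snd, zero_add]
      rw [abs_div, abs_of_pos hw, div_le_iff₀ hw]
      -- For an admissible curve both terms of `(g₂)'` carry the factor `|x|^α`, which is at most `C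
      -- |g₁|^α` and so cancels the denominator.
      calc _ = |(γ t).1| ^ α * |(chartDeriv α hα g (γ t)).im * u₁ t +
              (chartDeriv α hα g (γ t)).re * u₂ t| := by
            rw [← abs_of_nonneg hm, ← abs_mul, abs_of_nonneg hm]
            congr 1; ring
        _ ≤ (C * |(g (γ t)).1| ^ α) * (C * |u₁ t| + C * |u₂ t|) := by
            refine mul_le_mul hB.le_fst ((abs_add_le _ _).trans ?_) (abs_nonneg _) (by positivity)
            rw [abs_mul, abs_mul]
            have h1 := hB.im_le
            have h2 := hB.re_le
            gcongr
        _ = _ := by ring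
  -- Where the weight is nonzero, so almost everywhere, the controls are forced by the velocity.
  -- Taking `deriv` makes them measurable outright.
  refine ⟨h.absolutelyContinuous_comp hz hab hac hγΩ, deriv fun s => (g (γ s)).1,
    fun t => deriv (fun s => (g (γ s)).2) t / |(g (γ t)).1| ^ α, ?_, ?_, ?_⟩
  · refine Integrable.mono' ((hu₁.abs.const_mul (C ^ 2)).add (hu₂.abs.const_mul (C ^ 3)))
      (measurable_deriv _).aestronglyMeasurable ?_
    filter_upwards [key] with t ⟨w₁, w₂, h1, _, _, h3, _⟩
    rwa [h1.deriv]
  · refine Integrable.mono' ((hu₁.abs.const_mul (C ^ 2)).add (hu₂.abs.const_mul (C ^ 2)))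
      (aestronglyMeasurable_deriv_div hgc) ?_
    filter_upwards [key] with t ⟨w₁, w₂, _, h2, _, _, h4⟩
    rwa [h2.deriv]
  · filter_upwards [key] with t ⟨w₁, w₂, h1, h2, hw, _, _⟩
    rw [h1.deriv, h2.deriv]
    have e : w₁ • ((1, 0) : Plane) + (w₂ / |(g (γ t)).1| ^ α) •
        ((0, |((g ∘ γ) t).1| ^ α) : Plane) = (w₁, w₂) := by
      ext <;> simp [div_mul_cancel₀ _ hw]
    rw [e]
    exact h1.prodMk h2

/-- Absolutely continuous curves with admissible image are admissible. -/
lemma IsChartHolomorphic.isAdmissible_of_comp (h : IsChartHolomorphic α hα Ω g)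
    (hz : ∀ p ∈ Ω, (g p).1 = 0 ↔ p.1 = 0) (hab : a ≤ b)
    (hac : AbsolutelyContinuousOnInterval γ a b) (hγΩ : MapsTo γ (Icc a b) Ω)
    (hγ0 : ∀ᵐ t ∂(volume.restrict (Icc a b)), (γ t).1 ≠ 0)
    (hadm : IsAdmissible α a b (g ∘ γ)) : IsAdmissible α a b γ := by
  obtain ⟨-, U₁, U₂, -, hU₂, hd⟩ := hadm
  have hγc := hac.continuousOn
  rw [uIcc_of_le hab] at hγc
  obtain ⟨C, hC⟩ := h.exists_chartBound_curve hz hγc hγΩ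
  have hac1 : AbsolutelyContinuousOnInterval (fun t => (γ t).1) a b :=
    absolutelyContinuousOnInterval_comp (LipschitzWith.prod_fst.lipschitzOnWith (s := univ))
      (mapsTo_univ _ _) hac
  have hac2 : AbsolutelyContinuousOnInterval (fun t => (γ t).2) a b :=
    absolutelyContinuousOnInterval_comp (LipschitzWith.prod_snd.lipschitzOnWith (s := univ))
      (mapsTo_univ _ _) hac
  have hv₁ := (intervalIntegrable_iff_integrableOn_Icc_of_le hab).1 hac1.intervalIntegrable_deriv
  have hv₂ := (intervalIntegrable_iff_integrableOn_Icc_of_le hab).1 hac2.intervalIntegrable_deriv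
  have hgc : ContinuousOn (fun t => |(γ t).1| ^ α) (Icc a b) :=
    (continuous_abs_rpow hα).comp_continuousOn (continuous_fst.comp_continuousOn hγc)
  have hdiff : ∀ᵐ t ∂(volume.restrict (Icc a b)), HasDerivAt γ
      (deriv (fun t => (γ t).1) t, deriv (fun t => (γ t).2) t) t := by
    rw [ae_restrict_iff' measurableSet_Icc]
    filter_upwards [hac1.ae_differentiableAt, hac2.ae_differentiableAt] with t h1 h2 ht
    rw [uIcc_of_le hab] at h1 h2
    exact (h1 ht).hasDerivAt.prodMk (h2 ht).hasDerivAt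
  refine ⟨hac, deriv fun t => (γ t).1, fun t => deriv (fun t => (γ t).2) t / |(γ t).1| ^ α,
    hv₁, ?_, ?_⟩
  · refine Integrable.mono' (((hv₁.abs.const_mul (C ^ 2)).add (hv₂.abs.const_mul C)).add
      (hU₂.abs.const_mul (C ^ 2))) (aestronglyMeasurable_deriv_div hgc) ?_
    filter_upwards [hd, hdiff, hγ0, ae_restrict_mem measurableSet_Icc] with t ht ht' ht0 htm
    have hB := hC t htm
    have hC0 := hB.nonneg
    have hm : 0 < |(γ t).1| ^ α := by positivity
    have d2 : HasDerivAt (fun s => (g (γ s)).2) (U₂ t * |(g (γ t)).1| ^ α) t := by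
      have := (hasFDerivAt_snd (𝕜 := ℝ) (E := ℝ) (F := ℝ) (p := g (γ t))).comp_hasDerivAt t ht
      simpa [Function.comp_def] using this
    have heq := (h.hasDerivAt_comp ht' (hγΩ htm)).2.unique d2
    simp only at heq
    simp only [Pi.add_apply]
    set v₁ := deriv (fun t => (γ t).1) t
    set v₂ := deriv (fun t => (γ t).2) t
    rw [Real.norm_eq_abs, abs_div, abs_of_pos hm, div_le_iff₀ hm]
    -- The chain rule for `g₂` is solved for `Re F' y'`; both remaining terms are multiples of
    -- `|x|^α`, the first because `|g₁|^α ≤ C |x|^α`.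
    have e1 : |(chartDeriv α hα g (γ t)).re * v₂| ≤
        |U₂ t| * (C * |(γ t).1| ^ α) + |(γ t).1| ^ α * (C * |v₁|) := by
      have : (chartDeriv α hα g (γ t)).re * v₂ = U₂ t * |(g (γ t)).1| ^ α -
          |(γ t).1| ^ α * ((chartDeriv α hα g (γ t)).im * v₁) := by linarith
      rw [this]
      refine (abs_sub _ _).trans ?_
      rw [abs_mul, abs_mul, abs_mul, abs_of_pos hm,
        abs_of_nonneg (by positivity : 0 ≤ |(g (γ t)).1| ^ α)]
      have h1 := hB.fst_le
      have h2 := hB.im_le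
      gcongr
    -- `Re F'` may vanish away from the singular line, so division by it is avoided: `1 ≤ C (|x|^α +
    -- |Re F'|)` is multiplied by `|v₂|`. With `e1` every term then carries `|x|^α`.
    have e2 : |v₂| ≤ C * (|(γ t).1| ^ α * |v₂| + |(chartDeriv α hα g (γ t)).re * v₂|) := by
      have := mul_le_mul_of_nonneg_right hB.one_le (abs_nonneg v₂)
      rw [abs_mul]
      linarith
    have e3 := mul_le_mul_of_nonneg_left e1 hC0
    refine e2.trans ?_
    linarith
  · filter_upwards [hdiff, hγ0] with t ht ht0
    have hm : |(γ t).1| ^ α ≠ 0 := by positivity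
    convert ht using 1
    ext <;> simp [div_mul_cancel₀ _ hm]

end

end Grushin

theorem mainTheorem4 (α : ℝ) (hα : 0 < α) (Ω Ω' : Set Grushin.Plane)
    (hΩ : IsOpen Ω) (hΩ' : IsOpen Ω') (g : Grushin.Plane → Grushin.Plane)
    (hg : Grushin.MemHWMapLoc α (ENNReal.ofReal (2 * (α + 1) / α)) Ω Ω' g)
    (hconf : Grushin.IsConformal α Ω Ω' g)
    (hor : Grushin.IsOrientationPreserving α Ω Ω' g)
    (a b : ℝ) (hab : a ≤ b) (γ : ℝ → Grushin.Plane)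
    (hγ : AbsolutelyContinuousOnInterval γ a b) (hγΩ : MapsTo γ (Icc a b) Ω)
    (hγ0 : ∀ᵐ t ∂(volume.restrict (Icc a b)), (γ t).1 ≠ 0) :
    Grushin.IsAdmissible α a b γ ↔ Grushin.IsAdmissible α a b (g ∘ γ) := by
  have h := hconf.isChartHolomorphic hα hΩ hor
  have hz : ∀ p ∈ Ω, (g p).1 = 0 ↔ p.1 = 0 := fun p hp => hconf.fst_eq_zero_iff hα hΩ hor hp
  exact ⟨h.isAdmissible_comp hz hab hγΩ hγ0, h.isAdmissible_of_comp hz hab hγ hγΩ hγ0⟩
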